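/- Let $n\ge 1$. A signed permutation of $[n]=\{1,\dots,n\}$ is a bijection $\pi$ of $\{\pm1,\dots,\pm n\}$ with $\pi(-i)=-\pi(i)$; write $\pi_i=\pi(i)$, $\bar\imath=-i$, and let $|\pi|$ be the permutation $i\mapsto|\pi_i|$ of $[n]$. Products are compositions, $(\pi\tau)(x)=\pi(\tau(x))$. Let $\mathcal D_n$ be the group of signed permutations for which the number of $i\in[n]$ with $\pi_i<0$ is even. For $1\le i<j\le n$ let $t_{ij}$ be the signed permutation exchanging $i\leftrightarrow j$ and $\bar\imath\leftrightarrow\bar\jmath$, let $t_{\bar\imath j}$ be the one exchanging $\bar\imath\leftrightarrow j$ and $i\leftrightarrow\bar\jmath$, and for $1<j\le n$ let $t_{\bar\jmath j}$ be the one exchanging $1\leftrightarrow\bar1$ and $j\leftrightarrow\bar\jmath$ (all other letters being fixed). For $\pi\in\mathcal D_n$ define: - $\ell_D(\pi)$, the least number of factors in an expression of $\pi$ as a product of the generators $t_{i,i+1}$ ($1\le i<n$) and, if $n\ge2$, $t_{\bar12}$; - $\mathsf{sor}_D(\pi)=\sum_{r=1}^k\bigl(j_r-i_r-2\chi(i_r<0)\bigr)$,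 where $\pi=t_{i_1j_1}\cdots t_{i_kj_k}$ is the unique factorization of $\pi$ into elements $t_{ij}$ as above ($i$ possibly negative) with $1<j_1<\cdots<j_k\le n$, and $\chi(A)$ is $1$ if $A$ holds and $0$ otherwise; - $\mathsf{Rmil}_D^0(\pi)$ (resp. $\mathsf{Rmil}_D^1(\pi)$), the set of all $|\pi_i|$ with $\pi_i>0$ (resp. $\pi_i<0$) and $|\pi_i|<|\pi_j|$ for all $j>i$; $\mathsf{Rmil}_D^+(\pi)=\mathsf{Rmil}_D^0(\pi)\cup\{1\}$ and $\mathsf{Rmil}_D^-(\pi)=\mathsf{Rmil}_D^1(\pi)\setminus\{1\}$; - $\mathsf{Cyc}_D^0(\pi)$ (resp. $\mathsf{Cyc}_D^1(\pi)$), the set of the smallest elements of those cycles $C$ of $|\pi|$ for which $\#\{i\in C:\pi_i<0\}$ is even (resp. odd); $\mathsf{Cyc}_D^+(\pi)=\mathsf{Cyc}_D^0(\pi)\cup\{1\}$ and $\mathsf{Cyc}_D^-(\pi)=\mathsf{Cyc}_D^1(\pi)\setminus\{1\}$; - $\mathsf{lmin}_D(\pi)$, the number of $i$ with $|\pi_i|<|\pi_j|$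 for all $j<i$; - $\mathsf{lmic}_D(\pi)$, the number of left-to-right minima, in absolute value, of the word $\pi(1)\,\pi^2(1)\,\pi^3(1)\cdots$, i.e. the number of $k\ge1$ with $|\pi^k(1)|<|\pi^m(1)|$ for all $1\le m<k$. Let $\mathbf f=(f_1,\dots,f_n)$ be integers with $1\le f_1\le\cdots\le f_n\le n$ such that $$\mathcal D_{n,\mathbf f}=\{\pi\in\mathcal D_n:\ |\pi_i|\le f_i\text{ for }1\le i\le n\}$$ is non-empty, and let $h_j$ be the smallest position $i$ for which there is a signed permutation $\pi$ of $[n]$ with $|\pi_m|\le f_m$ for all $m$ and $|\pi_i|=j$. Let $\xi_A(\omega)=\omega$ if the statement $A$ is true and $\xi_A(\omega)=1$ otherwise. Then, for commuting variables $q,u,t_1,\dots,t_n,s_1,\dots,s_n$, $$\begin{aligned} &\sum_{\pi\in\mathcal D_{n,\mathbf f}}q^{\ell_D(\pi)}u^{\mathsf{lmin}_D(\pi)}\prod_{i\in\mathsf{Rmil}_D^+(\pi)}t_i\prod_{i\in\mathsf{Rmil}_D^-(\pi)}s_i\\ =&\sum_{\pi\in\mathcal D_{n,\mathbf f}}q^{\mathsf{sor}_D(\pi)}u^{\mathsf{lmic}_D(\pi)}\prod_{i\in\mathsf{Cyc}_D^+(\pi)}t_i\prod_{i\in\mathsf{Cyc}_D^-(\pi)}s_i\\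 =&\ t_1u\prod_{j=2}^n\Bigl(t_j+\sum_{i=h_j}^{j-1}\xi_{i=1}(u)\,\bigl(q^{j-i}+q^{j+i-2}\bigr)+s_jq^{2j-2}\Bigr). \end{aligned}$$ Explicitly, the $j$-th factor is $t_j+q+\cdots+q^{j-2}+2u\,q^{j-1}+q^{j}+\cdots+q^{2j-3}+s_jq^{2j-2}$ if $h_j=1$, it is $t_j+q+\cdots+q^{j-h_j}+q^{j+h_j-2}+\cdots+q^{2j-3}+s_jq^{2j-2}$ if $1<h_j<j$, and it is $t_j+s_jq^{2j-2}$ if $h_j=j$. -/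

import Mathlib

/-- A signed permutation of `{1, …, n}`, i.e. an element `(σ, z)` of the wreath product
`C₂ ≀ 𝔖ₙ`, with window notation `π₁ ⋯ πₙ`, `πᵢ = σᵢ^[zᵢ]`; the colour `1` is a bar, that is,
a minus sign.  The position or letter `k + 1` is represented by `k : Fin n`. -/
@[ext]
structure SignedPerm (n : ℕ) where
  /-- the base values `i ↦ σᵢ = |πᵢ|` -/
  perm : Equiv.Perm (Fin n)
  /-- the colours `i ↦ zᵢ` -/
  color : Fin n → ZMod 2

namespace SignedPerm

variable {n : ℕ}

/-- Signed permutations as pairs. -/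
def equivProd (n : ℕ) : SignedPerm n ≃ Equiv.Perm (Fin n) × (Fin n → ZMod 2) where
  toFun π := (π.perm, π.color)
  invFun p := ⟨p.1, p.2⟩
  left_inv _ := rfl
  right_inv _ := rfl

instance : DecidableEq (SignedPerm n) := (equivProd n).decidableEq

instance : Fintype (SignedPerm n) := Fintype.ofEquiv _ (equivProd n).symm

/-- The bijection of the coloured letters `i^[c]` defined by `π`:
`i^[c]` is sent to `σᵢ^[zᵢ + c]`. -/
def act (π : SignedPerm n) (x : Fin n × ZMod 2) : Fin n × ZMod 2 :=
  (π.perm x.1, π.color x.1 + x.2)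

/-- Multiplication is composition of the associated bijections, `(π τ)(x) = π (τ x)`. -/
instance : Mul (SignedPerm n) :=
  ⟨fun π τ => ⟨π.perm * τ.perm, fun i => π.color (τ.perm i) + τ.color i⟩⟩

instance : One (SignedPerm n) := ⟨⟨1, fun _ => 0⟩⟩

instance : Inv (SignedPerm n) := ⟨fun π => ⟨π.perm⁻¹, fun i => -π.color (π.perm⁻¹ i)⟩⟩

theorem mul_def (π τ : SignedPerm n) :
    π * τ = ⟨π.perm * τ.perm, fun i => π.color (τ.perm i) + τ.color i⟩ := rfl

theorem one_def : (1 : SignedPerm n) = ⟨1, fun _ => 0⟩ := rfl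

theorem inv_def (π : SignedPerm n) :
    π⁻¹ = ⟨π.perm⁻¹, fun i => -π.color (π.perm⁻¹ i)⟩ := rfl

instance : Group (SignedPerm n) :=
  Group.ofLeftAxioms
    (fun a b c => by
      simp only [mul_def, mul_assoc, Equiv.Perm.mul_apply, add_assoc])
    (fun a => by simp [mul_def, one_def])
    (fun a => by
      ext i
      · simp [mul_def, one_def, inv_def]
      · simp [mul_def, one_def, inv_def, CharTwo.add_self_eq_zero])

theorem act_mul (π τ : SignedPerm n) (x : Fin n × ZMod 2) :
    (π * τ).act x = π.act (τ.act x) := by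
  simp [act, mul_def, add_assoc]

/-- `π` has an even number of negative letters in its window, i.e. `π ∈ 𝒟ₙ`. -/
def IsEven (π : SignedPerm n) : Prop :=
  Even (Finset.univ.filter fun i => π.color i = 1).card

instance (π : SignedPerm n) : Decidable π.IsEven := inferInstanceAs (Decidable (Even _))

/-- `π` fits in the Ferrers shape of `f`: `|πᵢ| ≤ fᵢ` for all `i`. -/
def Fits (f : Fin n → ℕ) (π : SignedPerm n) : Prop :=
  ∀ i, (π.perm i : ℕ) + 1 ≤ f i

instance (f : Fin n → ℕ) (π : SignedPerm n) : Decidable (π.Fits f) :=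
  inferInstanceAs (Decidable (∀ i, (π.perm i : ℕ) + 1 ≤ f i))

/-- The signed transposition `(i^[c] j)` for `i < j`; it exchanges `i^[c]` with `j`, and the bar of
`i^[c]` with the bar of `j`. -/
def transp (i : Fin n) (c : ZMod 2) (j : Fin n) : SignedPerm n :=
  ⟨Equiv.swap i j, fun k => if k = i ∨ k = j then c else 0⟩

/-- The element `(1̄ 1)(j̄ j)`, for a letter `j > 1`. -/
def signFlip (j : Fin n) : SignedPerm n :=
  ⟨1, fun k => if (k : ℕ) = 0 ∨ k = j then 1 else 0⟩

/-- The Coxeter generators of type `D`: the transpositions `sᵢ = (i  i+1)` and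
`s₀ = (1̄ 2)`. -/
def coxeterGenD (n : ℕ) : Set (SignedPerm n) :=
  {g | ∃ i j : Fin n, (j : ℕ) = i + 1 ∧
    (g = transp i 0 j ∨ ((i : ℕ) = 0 ∧ g = transp i 1 j))}

/-- The length `ℓ_D(π)`: the least number of factors in an expression of `π` as a product of
Coxeter generators of type `D`. -/
noncomputable def lengthD (π : SignedPerm n) : ℕ :=
  sInf {k | ∃ w : List (SignedPerm n),
    (∀ g ∈ w, g ∈ coxeterGenD n) ∧ w.prod = π ∧ w.length = k}

/-- The indices of the elements `t_{i^[c] j}` of the generating set `𝒯ₙ` used for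
sorting: either `i < j` with `c` arbitrary, or `i = j > 1` and `c = 1`. -/
structure SortIndex (n : ℕ) where
  i : Fin n
  c : ZMod 2
  j : Fin n
  valid : i < j ∨ (i = j ∧ c = 1 ∧ 0 < (j : ℕ))

/-- The element `t_{i^[c] j}`: the signed transposition `(i^[c] j)` if `i < j`, and
`(1̄ 1)(j̄ j)` if `i = j`. -/
def SortIndex.toPerm (a : SortIndex n) : SignedPerm n :=
  if a.i = a.j then signFlip a.j else transp a.i a.c a.j

/-- The contribution of `t_{i^[c] j}` to the sorting index: `j - i` if `c = 0`, and
`j - (-i) - 2 = j + i - 2` if `c = 1` (the values of the letters are `a.i + 1` and `a.j + 1`, so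
neither subtraction is truncated). -/
def SortIndex.weight (a : SortIndex n) : ℕ :=
  if a.c = 0 then ((a.j : ℕ) + 1) - ((a.i : ℕ) + 1) else ((a.j : ℕ) + 1) + ((a.i : ℕ) + 1) - 2

/-- The sorting index `sor_D(π)`: the total contribution of the factors in the unique expression
of `π ∈ 𝒟ₙ` as a product `t_{x₁ j₁} ⋯ t_{x_k j_k}` with `j₁ < ⋯ < j_k`. -/
noncomputable def sorD (π : SignedPerm n) : ℕ :=
  sInf {m | ∃ w : List (SortIndex n), w.Pairwise (fun a b => a.j < b.j) ∧
    (w.map SortIndex.toPerm).prod = π ∧ (w.map SortIndex.weight).sum = m}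

/-- `Rmil^t(π)`: the (base values of the) right-to-left minimum letters of colour `t`,
`σᵢ < σⱼ` for all `j > i`. -/
def Rmil (t : ZMod 2) (π : SignedPerm n) : Finset ℕ :=
  (Finset.univ.filter fun i => π.color i = t ∧ ∀ j, i < j → π.perm i < π.perm j).image
    fun i => (π.perm i : ℕ) + 1

/-- `Rmil_D⁺`. -/
def RmilPlus (π : SignedPerm n) : Finset ℕ := Rmil 0 π ∪ {1}

/-- `Rmil_D⁻`. -/
def RmilMinus (π : SignedPerm n) : Finset ℕ := Rmil 1 π \ {1}

/-- `Cyc^t(π)`: the smallest letters of those cycles of `|π| = σ` for which the sum of the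
colours of the letters in the cycle is `t`. -/
def Cyc (t : ZMod 2) (π : SignedPerm n) : Finset ℕ :=
  (Finset.univ.filter fun i : Fin n => (∀ j, π.perm.SameCycle i j → i ≤ j) ∧
      ∑ j ∈ Finset.univ.filter (fun j => π.perm.SameCycle i j), π.color j = t).image
    fun i : Fin n => (i : ℕ) + 1

/-- `Cyc_D⁺`. -/
def CycPlus (π : SignedPerm n) : Finset ℕ := Cyc 0 π ∪ {1}

/-- `Cyc_D⁻`. -/
def CycMinus (π : SignedPerm n) : Finset ℕ := Cyc 1 π \ {1}

/-- `Lmil(π)`: the left-to-right minimum letters `σᵢ^[zᵢ]`, `σᵢ < σⱼ` for all `j < i`. -/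
def Lmil (π : SignedPerm n) : Finset (Fin n × ZMod 2) :=
  (Finset.univ.filter fun i => ∀ j, j < i → π.perm i < π.perm j).image
    fun i => (π.perm i, π.color i)

/-- `lmin_D(π)`. -/
def lmin (π : SignedPerm n) : ℕ := (Lmil π).card

open Classical in
/-- `Lmic(π)`: the left-to-right minimum letters of the word `π(1) π²(1) π³(1) ⋯`, where
letters are compared by their base values. -/
noncomputable def Lmic [NeZero n] (π : SignedPerm n) : Finset (Fin n × ZMod 2) :=
  Finset.univ.filter fun x => ∃ k : ℕ, 1 ≤ k ∧ x = (π.act)^[k] (0, 0) ∧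
    ∀ m : ℕ, 1 ≤ m → m < k → x.1 < ((π.act)^[m] (0, 0)).1

/-- `lmic_D(π)`. -/
noncomputable def lmic [NeZero n] (π : SignedPerm n) : ℕ := (Lmic π).card

/-- The set `𝒟_{n,f}` of even-signed permutations in the Ferrers shape of `f`. -/
def restrictedD (f : Fin n → ℕ) : Finset (SignedPerm n) :=
  Finset.univ.filter fun π => π.IsEven ∧ π.Fits f

/-- The entry `h_j` of `H(f)`: the smallest position at which the letter `j` (of any colour) can
appear in a signed permutation that fits in the Ferrers shape of `f`. -/
noncomputable def hIndex (f : Fin n → ℕ) (j : ℕ) : ℕ :=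
  sInf {p | ∃ π : SignedPerm n, π.Fits f ∧
    ∃ i : Fin n, (i : ℕ) + 1 = p ∧ (π.perm i : ℕ) + 1 = j}

end SignedPerm

namespace SignedPerm

variable {n : ℕ}

/-! Both sums are computed by peeling off the largest letter. Call a family `κ i c` of even signed
permutations inserting if `κ i c` puts the largest letter at position `i` with colour `c` and keeps
the base values of the earlier positions. Every element of rank `n + 1` is then uniquely `π.embed *
κ i c`, with `i` and `c` read off from the largest letter. The product is even exactly when `π` is.
Because the shape is monotone, the product fits `f` exactly when `π` fits the truncated shape and `f
i` admits the largest letter. So a sum over `restrictedD f` factors as soon as the summand does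
(`IsInserting.sum_restrictedD`).

Two inserting families are used. Inserting the letter into the window (`insertion`) is adapted to
length, left-to-right minima and right-to-left minima; multiplying by a sorting generator (`sorter`)
is adapted to sorting index, orbit minima and cycles. In both cases the weight is multiplied by the
same `insertFactor i c` (`lengthTerm_mul_insertion`, `sortTerm_mul_sorter`), so one induction,
`sum_restrictedD_eq_prod`, evaluates both sums.

Parity forces a colour change besides that of the new letter. When it may alter the sign class of an
old right-to-left minimum or cycle, the minimum concerned is the letter 1, whose sign the sets
`Plus` and `Minus` forget. Length becomes tractable through `lengthD_eq_invD`, which identifies it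
with an inversion count. -/

/-! ### Coordinates of products, and parity as a colour sum. -/

theorem mul_perm (π τ : SignedPerm n) : (π * τ).perm = π.perm * τ.perm := rfl

theorem mul_color (π τ : SignedPerm n) (i : Fin n) :
    (π * τ).color i = π.color (τ.perm i) + τ.color i := rfl

theorem one_perm : (1 : SignedPerm n).perm = 1 := rfl

theorem one_color (i : Fin n) : (1 : SignedPerm n).color i = 0 := rfl

theorem zmod_two_cases (c : ZMod 2) : c = 0 ∨ c = 1 := by
  revert c; decide

theorem isEven_iff (π : SignedPerm n) : π.IsEven ↔ ∑ i, π.color i = 0 := by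
  have h : ∑ i, π.color i = ((Finset.univ.filter fun i => π.color i = 1).card : ZMod 2) := by
    rw [Finset.card_filter, Nat.cast_sum]
    refine Finset.sum_congr rfl fun i _ => ?_
    rcases zmod_two_cases (π.color i) with h | h <;> simp [h]
  rw [h, ZMod.natCast_eq_zero_iff_even]
  rfl

theorem sum_color_mul (π τ : SignedPerm n) :
    ∑ i, (π * τ).color i = ∑ i, π.color i + ∑ i, τ.color i := by
  simp only [mul_color, Finset.sum_add_distrib]
  rw [Equiv.sum_comp τ.perm π.color]

/-! ### Embedding rank `n` into rank `n + 1`. -/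

/-- The extension of a permutation of `Fin n` to `Fin (n + 1)` that fixes the last letter. -/
def embedPerm (σ : Equiv.Perm (Fin n)) : Equiv.Perm (Fin (n + 1)) :=
  finSuccEquivLast.trans ((Equiv.optionCongr σ).trans finSuccEquivLast.symm)

@[simp] theorem embedPerm_castSucc (σ : Equiv.Perm (Fin n)) (k : Fin n) :
    embedPerm σ k.castSucc = (σ k).castSucc := by
  simp [embedPerm]

@[simp] theorem embedPerm_last (σ : Equiv.Perm (Fin n)) :
    embedPerm σ (Fin.last n) = Fin.last n := by
  simp [embedPerm]

/-- The extension of a signed permutation that fixes the last letter. -/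
def embed (π : SignedPerm n) : SignedPerm (n + 1) :=
  ⟨embedPerm π.perm, Fin.lastCases 0 π.color⟩

@[simp] theorem embed_perm (π : SignedPerm n) : π.embed.perm = embedPerm π.perm := rfl

@[simp] theorem embed_color_castSucc (π : SignedPerm n) (k : Fin n) :
    π.embed.color k.castSucc = π.color k := by
  simp [embed]

@[simp] theorem embed_color_last (π : SignedPerm n) :
    π.embed.color (Fin.last n) = 0 := by
  simp [embed]

theorem embed_injective : Function.Injective (embed : SignedPerm n → SignedPerm (n + 1)) := by
  intro π τ h
  ext k
  · have := congrArg (fun ρ : SignedPerm (n + 1) => (ρ.perm k.castSucc : ℕ)) h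
    simpa using this
  · have := congrArg (fun ρ : SignedPerm (n + 1) => ρ.color k.castSucc) h
    simpa using this

theorem embed_one : embed (1 : SignedPerm n) = 1 := by
  ext k
  · refine Fin.lastCases ?_ (fun k => ?_) k <;> simp [one_perm]
  · refine Fin.lastCases ?_ (fun k => ?_) k <;> simp [one_color]

theorem embed_mul (π τ : SignedPerm n) : embed (π * τ) = embed π * embed τ := by
  ext k
  · refine Fin.lastCases ?_ (fun k => ?_) k <;> simp [mul_perm]
  · refine Fin.lastCases ?_ (fun k => ?_) k <;> simp [mul_color]

theorem sum_color_embed (π : SignedPerm n) : ∑ i, π.embed.color i = ∑ i, π.color i := by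
  simp [Fin.sum_univ_castSucc]

theorem exists_embed_eq (π : SignedPerm (n + 1)) (hp : π.perm (Fin.last n) = Fin.last n)
    (hc : π.color (Fin.last n) = 0) : ∃ τ : SignedPerm n, τ.embed = π := by
  have hne : ∀ k : Fin n, π.perm k.castSucc ≠ Fin.last n := fun k h =>
    (Fin.castSucc_lt_last k).ne (π.perm.injective (h.trans hp.symm))
  have hinj : Function.Injective fun k : Fin n => (π.perm k.castSucc).castPred (hne k) := by
    intro k l h
    simpa using h
  refine ⟨⟨Equiv.ofBijective _ (Finite.injective_iff_bijective.1 hinj),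
    fun k => π.color k.castSucc⟩, ?_⟩
  ext k
  · refine Fin.lastCases ?_ (fun k => ?_) k
    · simp [hp]
    · simp
  · refine Fin.lastCases ?_ (fun k => ?_) k <;> simp [hc]

/-! ### Inserting families and the factorization of sums. -/

/-- A family of even signed permutations `κ i c` that send position `i` to the last letter
with colour `c`, and that fix the base values of all earlier positions. -/
structure IsInserting (κ : Fin (n + 1) → ZMod 2 → SignedPerm (n + 1)) : Prop where
  perm_self : ∀ i c, (κ i c).perm i = Fin.last n
  color_self : ∀ i c, (κ i c).color i = c
  perm_of_lt : ∀ i c m, m < i → (κ i c).perm m = m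
  sum_color : ∀ i c, ∑ m, (κ i c).color m = 0

namespace IsInserting

variable {κ : Fin (n + 1) → ZMod 2 → SignedPerm (n + 1)}

theorem mul_perm_self (hκ : IsInserting κ) (π : SignedPerm n) (i : Fin (n + 1)) (c : ZMod 2) :
    (π.embed * κ i c).perm i = Fin.last n := by
  simp [mul_perm, hκ.perm_self]

theorem mul_color_self (hκ : IsInserting κ) (π : SignedPerm n) (i : Fin (n + 1)) (c : ZMod 2) :
    (π.embed * κ i c).color i = c := by
  simp [mul_color, hκ.perm_self, hκ.color_self]

theorem mul_injective (hκ : IsInserting κ) {π τ : SignedPerm n} {i j : Fin (n + 1)} {c d : ZMod 2}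
    (h : π.embed * κ i c = τ.embed * κ j d) : π = τ ∧ i = j ∧ c = d := by
  have hij : i = j := by
    apply (π.embed * κ i c).perm.injective
    rw [hκ.mul_perm_self, h, hκ.mul_perm_self]
  subst hij
  have hcd : c = d := by
    rw [← hκ.mul_color_self π i c, h, hκ.mul_color_self]
  subst hcd
  exact ⟨embed_injective (mul_right_cancel h), rfl, rfl⟩

theorem exists_mul_eq (hκ : IsInserting κ) (π : SignedPerm (n + 1)) :
    ∃ (τ : SignedPerm n) (i : Fin (n + 1)) (c : ZMod 2), τ.embed * κ i c = π := by
  -- The position and colour of the largest letter in `π` dictate `i` and `c`; dividing by `κ i c`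
  -- on the right then leaves an element fixing that letter with colour 0.
  set i := π.perm.symm (Fin.last n) with hi
  have hs : (κ i (π.color i)).perm⁻¹ (Fin.last n) = i := by
    rw [Equiv.Perm.inv_eq_iff_eq, hκ.perm_self]
  obtain ⟨τ, hτ⟩ := exists_embed_eq (π * (κ i (π.color i))⁻¹)
    (by rw [mul_perm, inv_def, Equiv.Perm.mul_apply, hs, hi, Equiv.apply_symm_apply])
    (by rw [mul_color, inv_def]
        simp only
        rw [hs, hκ.color_self, add_neg_cancel])
  exact ⟨τ, i, π.color i, by rw [hτ, inv_mul_cancel_right]⟩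

theorem isEven_mul (hκ : IsInserting κ) (π : SignedPerm n) (i : Fin (n + 1)) (c : ZMod 2) :
    (π.embed * κ i c).IsEven ↔ π.IsEven := by
  rw [isEven_iff, isEven_iff, sum_color_mul, hκ.sum_color, add_zero, sum_color_embed]

/-- The Ferrers shape with the largest letter removed. -/
def _root_.SignedPerm.truncShape (f : Fin (n + 1) → ℕ) (k : Fin n) : ℕ := min (f k.castSucc) n

/-- Positions before `i` keep their letters, so their constraints carry over. From `i` on,
monotonicity gives bounds of at least `n + 1`, which constrain neither side. -/
theorem fits_mul (hκ : IsInserting κ) {f : Fin (n + 1) → ℕ} (hf : Monotone f) (π : SignedPerm n)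
    (i : Fin (n + 1)) (c : ZMod 2) :
    (π.embed * κ i c).Fits f ↔ n + 1 ≤ f i ∧ π.Fits (truncShape f) := by
  constructor
  · intro h
    have hi : n + 1 ≤ f i := by simpa [hκ.mul_perm_self] using h i
    refine ⟨hi, fun k => ?_⟩
    have hk := (π.perm k).isLt
    rw [truncShape, le_min_iff]
    refine ⟨?_, hk⟩
    rcases lt_or_ge k.castSucc i with hki | hki
    · simpa [mul_perm, hκ.perm_of_lt i c _ hki] using h k.castSucc
    · have := hf hki
      omega
  · rintro ⟨hi, h⟩ m
    rcases lt_or_ge m i with hm | hm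
    · obtain ⟨k, rfl⟩ : ∃ k : Fin n, k.castSucc = m :=
        ⟨m.castPred (hm.trans_le (Fin.le_last i)).ne, by simp⟩
      have := h k
      rw [truncShape, le_min_iff] at this
      simpa [mul_perm, hκ.perm_of_lt i c _ hm] using this.1
    · have := hf hm
      have := ((π.embed * κ i c).perm m).isLt
      omega

theorem mem_restrictedD_mul (hκ : IsInserting κ) {f : Fin (n + 1) → ℕ} (hf : Monotone f)
    (π : SignedPerm n) (i : Fin (n + 1)) (c : ZMod 2) :
    π.embed * κ i c ∈ restrictedD f ↔ π ∈ restrictedD (truncShape f) ∧ n + 1 ≤ f i := by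
  simp only [restrictedD, Finset.mem_filter, Finset.mem_univ, true_and, hκ.isEven_mul,
    hκ.fits_mul hf]
  tauto

/-- The shape restricts `π` and `i` independently and leaves `c` free, so the bijection `(π, i, c) ↦
π.embed * κ i c` turns the sum into a product of sums. -/
theorem sum_restrictedD (hκ : IsInserting κ) {f : Fin (n + 1) → ℕ} (hf : Monotone f)
    {R : Type*} [CommSemiring R] (F : SignedPerm (n + 1) → R) (F' : SignedPerm n → R)
    (g : Fin (n + 1) → ZMod 2 → R)
    (hF : ∀ π : SignedPerm n, π.IsEven → ∀ i c, F (π.embed * κ i c) = F' π * g i c) :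
    ∑ π ∈ restrictedD f, F π = (∑ π ∈ restrictedD (truncShape f), F' π) *
      ∑ i ∈ Finset.univ.filter (fun i => n + 1 ≤ f i), (g i 0 + g i 1) := by
  have h2 : ∀ i, g i 0 + g i 1 = ∑ c : ZMod 2, g i c := fun i => (Fin.sum_univ_two (g i)).symm
  simp only [h2]
  rw [← Finset.sum_product', Finset.sum_mul_sum, ← Finset.sum_product']
  symm
  refine Finset.sum_bij (fun x _ => x.1.embed * κ x.2.1 x.2.2) ?_ ?_ ?_ ?_
  · rintro ⟨π, i, c⟩ h
    simp only [Finset.mem_product, Finset.mem_filter, Finset.mem_univ, true_and, and_true] at h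
    exact (hκ.mem_restrictedD_mul hf π i c).2 h
  · rintro ⟨π, i, c⟩ _ ⟨τ, j, d⟩ _ h
    obtain ⟨rfl, rfl, rfl⟩ := hκ.mul_injective h
    rfl
  · intro π hπ
    obtain ⟨τ, i, c, rfl⟩ := hκ.exists_mul_eq π
    refine ⟨(τ, i, c), ?_, rfl⟩
    simpa using (hκ.mem_restrictedD_mul hf τ i c).1 hπ
  · rintro ⟨π, i, c⟩ h
    simp only [Finset.mem_product, restrictedD, Finset.mem_filter, Finset.mem_univ,
      true_and] at h
    exact (hF π h.1.1 i c).symm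

end IsInserting

/-! ### Type D inversions and length. -/

/-- The contribution of the pair of positions `i < j` to the number of type `D` inversions. -/
def pairInv (π : SignedPerm n) (i j : Fin n) : ℕ :=
  if π.perm j < π.perm i then 1 else if π.color j = 1 then 2 else 0

/-- The number of type `D` inversions: pairs `i < j` with `πᵢ > πⱼ`, plus pairs `i < j` with
`πᵢ + πⱼ < 0`. -/
def invD (π : SignedPerm n) : ℕ :=
  ∑ i, ∑ j, if i < j then pairInv π i j else 0

theorem invD_one : invD (1 : SignedPerm n) = 0 := by
  refine Finset.sum_eq_zero fun i _ => Finset.sum_eq_zero fun j _ => ?_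
  split_ifs with h
  · simp [pairInv, one_perm, one_color, h.le]
  · rfl

theorem invD_eq_add (π : SignedPerm n) {a b : Fin n} (hab : a < b) :
    invD π = pairInv π a b + ∑ p ∈ Finset.univ.filter
      (fun p : Fin n × Fin n => p.1 < p.2 ∧ p ≠ (a, b)), pairInv π p.1 p.2 := by
  rw [invD, ← Finset.sum_product', Finset.univ_product_univ, ← Finset.sum_filter,
    ← Finset.add_sum_erase _ _ (a := (a, b)) (by simpa using hab)]
  congr 1
  refine Finset.sum_congr ?_ fun _ _ => rfl
  ext p
  simp [and_comm]

theorem swap_lt_swap {a b : Fin n} (hab : (b : ℕ) = a + 1) {i j : Fin n} (hij : i < j)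
    (hne : ¬(i = a ∧ j = b)) :
    Equiv.swap a b i < Equiv.swap a b j ∧ ¬(Equiv.swap a b i = a ∧ Equiv.swap a b j = b) := by
  simp only [Equiv.swap_apply_def, Fin.ext_iff, Fin.lt_def] at *
  split_ifs <;> omega

theorem transp_perm (i : Fin n) (c : ZMod 2) (j : Fin n) :
    (transp i c j).perm = Equiv.swap i j := rfl

theorem transp_color (i : Fin n) (c : ZMod 2) (j k : Fin n) :
    (transp i c j).color k = if k = i ∨ k = j then c else 0 := rfl

/-- A generator permutes the pairs of positions other than `(a, b)` without changing their
contributions. The equation is stated additively to avoid truncated subtraction. -/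
theorem invD_mul_transp (π : SignedPerm n) {a b : Fin n} (hab : (b : ℕ) = a + 1) (c : ZMod 2)
    (hc : c = 0 ∨ (a : ℕ) = 0) :
    invD (π * transp a c b) + pairInv π a b =
      invD π + pairInv (π * transp a c b) a b := by
  have hlt : a < b := by rw [Fin.lt_def]; omega
  rw [invD_eq_add π hlt, invD_eq_add _ hlt]
  suffices h : ∑ p ∈ Finset.univ.filter
      (fun p : Fin n × Fin n => p.1 < p.2 ∧ p ≠ (a, b)), pairInv (π * transp a c b) p.1 p.2 =
      ∑ p ∈ Finset.univ.filter
      (fun p : Fin n × Fin n => p.1 < p.2 ∧ p ≠ (a, b)), pairInv π p.1 p.2 by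
    rw [h]; ring
  refine Finset.sum_equiv ((Equiv.swap a b).prodCongr (Equiv.swap a b)) ?_ ?_
  · rintro ⟨i, j⟩
    simp only [Finset.mem_filter, Finset.mem_univ, true_and, ne_eq, Prod.mk.injEq,
      Equiv.prodCongr_apply, Prod.map_apply]
    constructor
    · rintro ⟨h1, h2⟩
      exact swap_lt_swap hab h1 h2
    · rintro ⟨h1, h2⟩
      simpa using swap_lt_swap hab h1 h2
  · rintro ⟨i, j⟩ h
    simp only [Finset.mem_filter, Finset.mem_univ, true_and, ne_eq, Prod.mk.injEq] at h
    -- `pairInv` reads only the colour of the later position. With `c = 1` the recoloured positions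
    -- are the first two, and the only pair ending in one of them is the excluded `(a, b)`.
    have hcol : (transp a c b).color j = 0 := by
      rw [transp_color]
      split_ifs with h'
      · rcases hc with hc | hc
        · exact hc
        · exfalso
          simp only [Fin.ext_iff, Fin.lt_def] at *
          omega
      · rfl
    simp only [pairInv, mul_perm, transp_perm, Equiv.Perm.mul_apply, mul_color, hcol, add_zero,
      Equiv.prodCongr_apply, Prod.map_apply]

theorem pairInv_mul_transp (π : SignedPerm n) (a b : Fin n) (c : ZMod 2) :
    pairInv (π * transp a c b) a b =
      if π.perm a < π.perm b then 1 else if π.color a + c = 1 then 2 else 0 := by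
  simp [pairInv, mul_perm, mul_color, transp_perm, transp_color]

theorem invD_mul_gen_le (π g : SignedPerm n) (hg : g ∈ coxeterGenD n) :
    invD (π * g) ≤ invD π + 1 := by
  obtain ⟨a, b, hab, h⟩ := hg
  have hlt : a < b := by rw [Fin.lt_def]; omega
  obtain ⟨c, hc, rfl⟩ : ∃ c : ZMod 2, (c = 0 ∨ (a : ℕ) = 0) ∧ g = transp a c b := by
    rcases h with h | ⟨h0, h⟩
    · exact ⟨0, Or.inl rfl, h⟩
    · exact ⟨1, Or.inr h0, h⟩
  have h1 := invD_mul_transp π hab c hc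
  rw [pairInv_mul_transp] at h1
  have hne : π.perm a ≠ π.perm b := fun h => hlt.ne (π.perm.injective h)
  rcases lt_or_gt_of_ne hne with h2 | h2
  · rw [if_pos h2] at h1
    omega
  · rw [if_neg h2.le.not_gt, pairInv, if_pos h2] at h1
    split_ifs at h1 <;> omega

theorem invD_prod_le (w : List (SignedPerm n)) (hw : ∀ g ∈ w, g ∈ coxeterGenD n) :
    invD w.prod ≤ w.length := by
  induction w using List.reverseRecOn with
  | nil => simp [invD_one]
  | append_singleton w g ih =>
    have h1 := ih fun x hx => hw x (by simp [hx])
    have h2 := invD_mul_gen_le w.prod g (hw g (by simp))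
    simp only [List.prod_append, List.prod_singleton, List.length_append, List.length_singleton]
    omega

theorem transp_mul_self (a b : Fin n) (c : ZMod 2) :
    transp a c b * transp a c b = 1 := by
  ext k
  · simp [mul_perm, transp_perm, one_perm]
  · have : (Equiv.swap a b k = a ∨ Equiv.swap a b k = b) ↔ (k = a ∨ k = b) := by
      simp only [Equiv.swap_apply_def]
      split_ifs <;> simp_all
    rw [mul_color, transp_perm, transp_color, transp_color, one_color]
    simp only [this]
    exact CharTwo.add_self_eq_zero _

theorem isEven_mul_transp (π : SignedPerm n) (hπ : π.IsEven) {a b : Fin n} (hab : a ≠ b)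
    (c : ZMod 2) : (π * transp a c b).IsEven := by
  rw [isEven_iff] at *
  have : ∑ i, (transp a c b).color i = c + c := by
    simp only [transp_color]
    rw [← Finset.sum_filter, Finset.sum_const]
    have : Finset.univ.filter (fun k => k = a ∨ k = b) = {a, b} := by ext; simp
    rw [this, Finset.card_pair hab, two_nsmul]
  rw [sum_color_mul, hπ, this, CharTwo.add_self_eq_zero, add_zero]

/-- A nonidentity even element always has a generator lowering `invD`: this is the descent step
behind the reduced word. -/
theorem eq_one_of_forall_le (π : SignedPerm n) (hπ : π.IsEven)
    (h : ∀ (a b : Fin n) (c : ZMod 2), (b : ℕ) = a + 1 → (c = 0 ∨ (a : ℕ) = 0) →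
      invD π ≤ invD (π * transp a c b)) : π = 1 := by
  have key : ∀ (a b : Fin n) (c : ZMod 2), (b : ℕ) = a + 1 → (c = 0 ∨ (a : ℕ) = 0) →
      pairInv π a b ≤ if π.perm a < π.perm b then 1 else if π.color a + c = 1 then 2 else 0 := by
    intro a b c hab hc
    have h1 := h a b c hab hc
    have h2 := invD_mul_transp π hab c hc
    rw [pairInv_mul_transp] at h2
    omega
  have asc : ∀ (k : ℕ) (hk : k + 1 < n),
      π.perm ⟨k, by omega⟩ < π.perm ⟨k + 1, hk⟩ ∧ π.color ⟨k + 1, hk⟩ = 0 := by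
    intro k
    induction k with
    | zero =>
      intro hk
      -- A descent at the first two positions contributes 1, and the generator whose `c` equals the
      -- colour of the first position lowers this to 0. An ascent ending in a barred letter
      -- contributes 2, and swapping lowers it to 1.
      have h0 := key ⟨0, by omega⟩ ⟨0 + 1, hk⟩ 0 rfl (Or.inl rfl)
      have h1 := key ⟨0, by omega⟩ ⟨0 + 1, hk⟩ 1 rfl (Or.inr rfl)
      have hne : π.perm ⟨0, by omega⟩ ≠ π.perm ⟨0 + 1, hk⟩ := fun h => by
        simpa using π.perm.injective h
      rcases lt_or_gt_of_ne hne with hlt | hgt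
      · refine ⟨hlt, ?_⟩
        rw [pairInv, if_neg hlt.le.not_gt, if_pos hlt] at h0
        rcases zmod_two_cases (π.color ⟨0 + 1, hk⟩) with hc | hc
        · exact hc
        · simp [hc] at h0
      · rw [pairInv, if_pos hgt, if_neg hgt.le.not_gt] at h0 h1
        rcases zmod_two_cases (π.color ⟨0, by omega⟩) with hc | hc
        · simp [hc] at h0
        · rw [hc] at h1
          have : ¬ ((1 : ZMod 2) + 1 = 1) := by decide
          simp [this] at h1
    | succ k ih =>
      intro hk
      -- The letter at position `k + 1` is already unbarred, so swapping a descent there would lower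
      -- its contribution from 1 to 0 without the help of `s₀`.
      have ihk := (ih (by omega)).2
      have h0 := key ⟨k + 1, by omega⟩ ⟨k + 1 + 1, hk⟩ 0 rfl (Or.inl rfl)
      have hne : π.perm ⟨k + 1, by omega⟩ ≠ π.perm ⟨k + 1 + 1, hk⟩ := fun h => by
        simpa using π.perm.injective h
      rcases lt_or_gt_of_ne hne with hlt | hgt
      · refine ⟨hlt, ?_⟩
        rw [pairInv, if_neg hlt.le.not_gt, if_pos hlt] at h0
        rcases zmod_two_cases (π.color ⟨k + 1 + 1, hk⟩) with hc | hc
        · exact hc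
        · simp [hc] at h0
      · rw [pairInv, if_pos hgt, if_neg hgt.le.not_gt] at h0
        simp [ihk] at h0
  have hcol : ∀ i : Fin n, (i : ℕ) ≠ 0 → π.color i = 0 := by
    rintro ⟨_ | k, hk⟩ h
    · simp at h
    · exact (asc k hk).2
  have hmono : StrictMono π.perm := by
    cases n with
    | zero => exact fun i => i.elim0
    | succ m => exact Fin.strictMono_iff_lt_succ.2 fun i => (asc i (by omega)).1
  have hperm : ∀ i, π.perm i = i := fun i => by
    have := Subsingleton.elim (hmono.orderIsoOfSurjective _ π.perm.surjective)
      (OrderIso.refl (Fin n))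
    simpa using congrArg (fun e : Fin n ≃o Fin n => e i) this
  ext i
  · rw [hperm, one_perm, Equiv.Perm.one_apply]
  · rw [one_color]
    by_cases hi : (i : ℕ) = 0
    · rw [isEven_iff, Finset.sum_eq_single i] at hπ
      · exact hπ
      · intro j _ hj
        exact hcol j fun h => hj (Fin.ext (h.trans hi.symm))
      · simp
    · exact hcol i hi

/-- Greedy descent: each chosen generator is an involution lowering `invD` by at least one. -/
theorem exists_word_length_eq_invD (π : SignedPerm n) (hπ : π.IsEven) :
    ∃ w : List (SignedPerm n), (∀ g ∈ w, g ∈ coxeterGenD n) ∧ w.prod = π ∧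
      w.length ≤ invD π := by
  induction hk : invD π using Nat.strong_induction_on generalizing π with
  | _ k ih =>
    by_cases h : ∀ (a b : Fin n) (c : ZMod 2), (b : ℕ) = a + 1 → (c = 0 ∨ (a : ℕ) = 0) →
      invD π ≤ invD (π * transp a c b)
    · exact ⟨[], by simp, by simp [eq_one_of_forall_le π hπ h], by simp⟩
    · push Not at h
      obtain ⟨a, b, c, hab, hc, hlt⟩ := h
      have hne : a ≠ b := fun h => by rw [h] at hab; omega
      obtain ⟨w, hw, hprod, hlen⟩ := ih _ (hk ▸ hlt) _ (isEven_mul_transp π hπ hne c) rfl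
      refine ⟨w ++ [transp a c b], ?_, ?_, ?_⟩
      · intro g hg
        rcases List.mem_append.1 hg with hg | hg
        · exact hw g hg
        · rw [List.mem_singleton.1 hg]
          refine ⟨a, b, hab, ?_⟩
          rcases zmod_two_cases c with rfl | rfl
          · exact Or.inl rfl
          · exact Or.inr ⟨hc.resolve_left one_ne_zero, rfl⟩
      · rw [List.prod_append, hprod, List.prod_singleton, mul_assoc, transp_mul_self, mul_one]
      · simp only [List.length_append, List.length_singleton]
        omega

theorem lengthD_eq_invD (π : SignedPerm n) (hπ : π.IsEven) : lengthD π = invD π := by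
  obtain ⟨w, hw, hprod, hlen⟩ := exists_word_length_eq_invD π hπ
  apply le_antisymm
  · have : lengthD π ≤ w.length := Nat.sInf_le ⟨w, hw, hprod, rfl⟩
    exact this.trans hlen
  · refine le_csInf ⟨_, w, hw, hprod, rfl⟩ ?_
    rintro k ⟨v, hv, rfl, rfl⟩
    exact invD_prod_le v hv

/-! ### Insertion into the window. -/

/-- The even signed permutation whose window is obtained from `1 2 ⋯ n` by inserting the letter
`(n + 1)^[c]` at position `i` and giving the colour `c` to the letter `1`. -/
def insertion (i : Fin (n + 1)) (c : ZMod 2) : SignedPerm (n + 1) :=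
  ⟨(finSuccEquiv' i).trans (finSuccEquiv' (Fin.last n)).symm,
    i.insertNth c fun k : Fin n => if (k : ℕ) = 0 then c else 0⟩

@[simp] theorem insertion_perm_self (i : Fin (n + 1)) (c : ZMod 2) :
    (insertion i c).perm i = Fin.last n := by
  simp [insertion]

@[simp] theorem insertion_perm_succAbove (i : Fin (n + 1)) (c : ZMod 2) (k : Fin n) :
    (insertion i c).perm (i.succAbove k) = k.castSucc := by
  simp [insertion]

@[simp] theorem insertion_color_self (i : Fin (n + 1)) (c : ZMod 2) :
    (insertion i c).color i = c := by
  simp [insertion]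

@[simp] theorem insertion_color_succAbove (i : Fin (n + 1)) (c : ZMod 2) (k : Fin n) :
    (insertion i c).color (i.succAbove k) = if (k : ℕ) = 0 then c else 0 := by
  simp [insertion]

/-- `NeZero n` supplies a letter 1 distinct from the inserted one; its colour `c` cancels that of
the inserted letter. -/
theorem isInserting_insertion [NeZero n] :
    IsInserting (insertion : Fin (n + 1) → ZMod 2 → SignedPerm (n + 1)) where
  perm_self := insertion_perm_self
  color_self := insertion_color_self
  perm_of_lt i c m h := by
    obtain ⟨k, rfl⟩ : ∃ k : Fin n, k.castSucc = m :=
      ⟨m.castPred (h.trans_le (Fin.le_last i)).ne, by simp⟩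
    have := insertion_perm_succAbove i c k
    rwa [Fin.succAbove_of_castSucc_lt i k h] at this
  sum_color i c := by
    rw [Fin.sum_univ_succAbove _ i]
    simp only [insertion_color_self, insertion_color_succAbove]
    rw [Finset.sum_eq_single (0 : Fin n)]
    · simpa using CharTwo.add_self_eq_zero c
    · intro k _ hk
      rw [if_neg]
      exact fun h => hk (Fin.ext (by simpa using h))
    · simp

/-- The exponent of `q` contributed by inserting the last letter with colour `c` at
position `i`. -/
def insertWeight (i : Fin (n + 1)) (c : ZMod 2) : ℕ := if c = 0 then n - i else n + i

section Insertion

variable (π : SignedPerm n) (i : Fin (n + 1)) (c : ZMod 2) (k : Fin n)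

@[simp] theorem mul_insertion_perm_self :
    (π.embed * insertion i c).perm i = Fin.last n := by simp [mul_perm]

@[simp] theorem mul_insertion_perm_succAbove :
    (π.embed * insertion i c).perm (i.succAbove k) = (π.perm k).castSucc := by simp [mul_perm]

@[simp] theorem mul_insertion_color_self :
    (π.embed * insertion i c).color i = c := by simp [mul_color]

@[simp] theorem mul_insertion_color_succAbove :
    (π.embed * insertion i c).color (i.succAbove k) =
      π.color k + if (k : ℕ) = 0 then c else 0 := by simp [mul_color]

theorem sum_lt_succAbove : ∑ k : Fin n, (if i < i.succAbove k then 1 else 0) = n - (i : ℕ) := by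
  have := Fin.sum_univ_succAbove (fun m => if i < m then 1 else 0) i
  simp only [lt_self_iff_false, if_false, zero_add] at this
  rw [← this, ← Finset.card_filter]
  have : Finset.univ.filter (fun m => i < m) = Finset.Ioi i := by ext; simp
  rw [this, Fin.card_Ioi]
  omega

theorem sum_succAbove_lt : ∑ k : Fin n, (if i.succAbove k < i then 1 else 0) = (i : ℕ) := by
  have := Fin.sum_univ_succAbove (fun m => if m < i then 1 else 0) i
  simp only [lt_self_iff_false, if_false, zero_add] at this
  rw [← this, ← Finset.card_filter]
  have : Finset.univ.filter (fun m => m < i) = Finset.Iio i := by ext; simp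
  rw [this, Fin.card_Iio]

/-- The new letter has the largest base value: each of the `n - i` later positions contributes 1
with it, and each of the `i` earlier ones contributes 2 if it is barred and 0 otherwise. The
recolouring of the first old position is invisible, since that position is never the later one of an
old pair. -/
theorem invD_mul_insertion : invD (π.embed * insertion i c) = invD π + insertWeight i c := by
  have h1 : ∀ k : Fin n, (if i < i.succAbove k then
      pairInv (π.embed * insertion i c) i (i.succAbove k) else 0) =
      if i < i.succAbove k then 1 else 0 := by
    intro k
    simp [pairInv, Fin.castSucc_lt_last]
  have h2 : ∀ k : Fin n, (if i.succAbove k < i then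
      pairInv (π.embed * insertion i c) (i.succAbove k) i else 0) =
      (if i.succAbove k < i then 1 else 0) * (if c = 1 then 2 else 0) := by
    intro k
    by_cases hc : c = 1 <;> simp [pairInv, (Fin.le_last _).not_gt, hc]
  have h3 : ∀ k l : Fin n, (if i.succAbove k < i.succAbove l then
      pairInv (π.embed * insertion i c) (i.succAbove k) (i.succAbove l) else 0) =
      if k < l then pairInv π k l else 0 := by
    intro k l
    simp only [Fin.succAbove_lt_succAbove_iff]
    split_ifs with h
    · have : (l : ℕ) ≠ 0 := by rw [Fin.lt_def] at h; omega
      simp [pairInv, this]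
    · rfl
  rw [invD, Fin.sum_univ_succAbove _ i]
  simp only [Fin.sum_univ_succAbove _ i, lt_self_iff_false, if_false, zero_add, h1, h2, h3,
    Finset.sum_add_distrib, ← Finset.sum_mul, sum_lt_succAbove, sum_succAbove_lt]
  rw [invD, insertWeight]
  rcases zmod_two_cases c with rfl | rfl
  · simp [add_comm]
  · simp only [if_true, one_ne_zero, if_false]
    omega

theorem lmin_eq (π : SignedPerm n) :
    lmin π = ∑ i, if ∀ j, j < i → π.perm i < π.perm j then 1 else 0 := by
  rw [lmin, Lmil, Finset.card_image_of_injective, Finset.card_filter]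
  intro i j h
  exact π.perm.injective (Prod.mk.inj h).1

theorem lmin_mul_insertion [NeZero n] : lmin (π.embed * insertion i c) =
    lmin π + if i = 0 then 1 else 0 := by
  rw [lmin_eq, lmin_eq, Fin.sum_univ_succAbove _ i, add_comm]
  congr 1
  · refine Finset.sum_congr rfl fun k _ => ?_
    congr 1
    apply propext
    rw [Fin.forall_iff_succAbove i]
    simp [Fin.castSucc_lt_last]
  · congr 1
    apply propext
    simp only [mul_insertion_perm_self, (Fin.le_last _).not_gt, imp_false]
    constructor
    · intro h
      by_contra h0
      exact h 0 (Fin.pos_of_ne_zero h0)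
    · rintro rfl j
      exact not_lt_bot

theorem mem_Rmil (t : ZMod 2) (π : SignedPerm n) (x : ℕ) : x ∈ Rmil t π ↔
    ∃ i, (π.color i = t ∧ ∀ j, i < j → π.perm i < π.perm j) ∧ (π.perm i : ℕ) + 1 = x := by
  simp [Rmil]

/-- The recoloured first position can be a right-to-left minimum only by holding the letter 1, which
is why the next lemma assumes `x ≠ 1`. -/
theorem perm_eq_zero_of_lt [NeZero n] (hk : (k : ℕ) = 0)
    (h : ∀ j, k < j → π.perm k < π.perm j) : (π.perm k : ℕ) = 0 := by
  by_contra h0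
  set m := π.perm.symm 0 with hm
  have hmk : π.perm m = 0 := by simp [hm]
  have hkm : k ≠ m := fun h' => h0 (by rw [h', hmk]; simp)
  have := h m (by rw [Fin.lt_def, hk]; exact Nat.pos_of_ne_zero fun h' => hkm (Fin.ext (by omega)))
  simp [hmk] at this

theorem mem_Rmil_mul_insertion [NeZero n] (t : ZMod 2) {x : ℕ} (hx : x ≠ 1) :
    x ∈ Rmil t (π.embed * insertion i c) ↔
      x ∈ Rmil t π ∨ (i = Fin.last n ∧ c = t ∧ x = n + 1) := by
  rw [mem_Rmil, Fin.exists_iff_succAbove i, mem_Rmil, or_comm]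
  refine or_congr (exists_congr fun k => ?_) ?_
  · rw [Fin.forall_iff_succAbove i]
    simp only [mul_insertion_color_succAbove, mul_insertion_perm_succAbove,
      mul_insertion_perm_self, Fin.castSucc_lt_last, implies_true, true_and,
      Fin.succAbove_lt_succAbove_iff, Fin.castSucc_lt_castSucc_iff, Fin.val_castSucc]
    by_cases hk : (k : ℕ) = 0
    · have : ¬((∀ j, k < j → π.perm k < π.perm j) ∧ (π.perm k : ℕ) + 1 = x) := by
        rintro ⟨h1, h2⟩
        rw [perm_eq_zero_of_lt π k hk h1] at h2
        exact hx h2.symm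
      tauto
    · simp [hk]
  · simp only [mul_insertion_color_self, mul_insertion_perm_self, (Fin.le_last _).not_gt,
      imp_false, Fin.val_last]
    constructor
    · rintro ⟨⟨h1, h2⟩, h3⟩
      exact ⟨le_antisymm (Fin.le_last i) (not_lt.1 (h2 _)), h1, h3.symm⟩
    · rintro ⟨rfl, h1, h2⟩
      exact ⟨⟨h1, fun j => (Fin.le_last j).not_gt⟩, h2.symm⟩

end Insertion

/-! ### Multiplication by a sorting generator. -/

/-- The sorting element `t_{i^[c] j}` for the last letter `j`, or the identity if `i` is last and
`c = 0`. -/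
def sorter (i : Fin (n + 1)) (c : ZMod 2) : SignedPerm (n + 1) :=
  if i = Fin.last n then if c = 0 then 1 else signFlip (Fin.last n) else transp i c (Fin.last n)

theorem signFlip_color (j k : Fin n) :
    (signFlip j).color k = if (k : ℕ) = 0 ∨ k = j then 1 else 0 := rfl

theorem sorter_castSucc (a : Fin n) (c : ZMod 2) :
    sorter a.castSucc c = transp a.castSucc c (Fin.last n) :=
  if_neg (Fin.castSucc_lt_last a).ne

theorem sorter_last_zero : sorter (Fin.last n) 0 = 1 := by simp [sorter]

theorem sorter_last_one : sorter (Fin.last n) 1 = signFlip (Fin.last n) := by simp [sorter]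

theorem sorter_last_perm (c : ZMod 2) : (sorter (Fin.last n) c).perm = 1 := by
  rcases zmod_two_cases c with rfl | rfl
  · rw [sorter_last_zero, one_perm]
  · rw [sorter_last_one, signFlip]

theorem sorter_perm (i : Fin (n + 1)) (c : ZMod 2) :
    (sorter i c).perm = Equiv.swap i (Fin.last n) := by
  refine Fin.lastCases ?_ (fun a => ?_) i
  · rw [sorter_last_perm, Equiv.swap_self]; rfl
  · rw [sorter_castSucc, transp_perm]

theorem sorter_perm_le (i : Fin (n + 1)) (c : ZMod 2) (m : Fin (n + 1)) (hm : m ≠ i) :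
    (sorter i c).perm m ≤ m := by
  rw [sorter_perm, Equiv.swap_apply_def, if_neg hm]
  split_ifs with h
  · exact h ▸ Fin.le_last i
  · exact le_rfl

theorem isInserting_sorter [NeZero n] :
    IsInserting (sorter : Fin (n + 1) → ZMod 2 → SignedPerm (n + 1)) where
  perm_self i c := by simp [sorter_perm]
  color_self i c := by
    refine Fin.lastCases ?_ (fun a => ?_) i
    · rcases zmod_two_cases c with rfl | rfl
      · simp [sorter_last_zero, one_color]
      · simp [sorter_last_one, signFlip]
    · simp [sorter_castSucc, transp_color]
  perm_of_lt i c m h := by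
    rw [sorter_perm, Equiv.swap_apply_of_ne_of_ne h.ne (h.trans_le (Fin.le_last i)).ne]
  sum_color i c := by
    refine Fin.lastCases ?_ (fun a => ?_) i
    · rcases zmod_two_cases c with rfl | rfl
      · simp [sorter_last_zero, one_color]
      · rw [sorter_last_one, Fin.sum_univ_castSucc, Finset.sum_eq_single (0 : Fin n)]
        · simpa [signFlip] using CharTwo.add_self_eq_zero (1 : ZMod 2)
        · intro k _ hk
          rw [signFlip_color, if_neg]
          rintro (h | h)
          · exact hk (Fin.ext (by simpa using h))
          · exact (Fin.castSucc_lt_last k).ne h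
        · simp
    · rw [sorter_castSucc, Fin.sum_univ_castSucc]
      simp [transp_color, (Fin.castSucc_lt_last _).ne, CharTwo.add_self_eq_zero]

/-! ### The sorting index. -/

section SortingIndex

/-- The extension of a sorting index to one more letter. -/
def SortIndex.lift (a : SortIndex n) : SortIndex (n + 1) where
  i := a.i.castSucc
  c := a.c
  j := a.j.castSucc
  valid := by simpa using a.valid

theorem SortIndex.weight_lift (a : SortIndex n) : a.lift.weight = a.weight := by
  simp [SortIndex.weight, SortIndex.lift]

theorem embedPerm_swap (a b : Fin n) :
    embedPerm (Equiv.swap a b) = Equiv.swap a.castSucc b.castSucc := by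
  ext k
  refine Fin.lastCases ?_ (fun k => ?_) k
  · rw [embedPerm_last, Equiv.swap_apply_of_ne_of_ne (Fin.castSucc_lt_last a).ne'
      (Fin.castSucc_lt_last b).ne']
  · rw [embedPerm_castSucc, (Fin.castSucc_injective n).swap_apply]

theorem SortIndex.toPerm_lift (a : SortIndex n) : a.lift.toPerm = a.toPerm.embed := by
  unfold SortIndex.toPerm
  by_cases h : a.i = a.j
  · rw [if_pos h, if_pos (by simp [SortIndex.lift, h])]
    have hn : n ≠ 0 := by have := a.j.isLt; omega
    ext k
    · refine Fin.lastCases ?_ (fun k => ?_) k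
      · simp [signFlip]
      · simp [signFlip]
    · refine Fin.lastCases ?_ (fun k => ?_) k
      · simp [signFlip, hn, SortIndex.lift, (Fin.castSucc_lt_last _).ne']
      · simp only [signFlip_color, SortIndex.lift, embed_color_castSucc, Fin.val_castSucc,
          Fin.castSucc_inj]
  · rw [if_neg h, if_neg (by simpa [SortIndex.lift] using h)]
    ext k
    · rw [embed_perm, transp_perm, transp_perm, embedPerm_swap]
      rfl
    · refine Fin.lastCases ?_ (fun k => ?_) k
      · simp [transp_color, SortIndex.lift, (Fin.castSucc_lt_last _).ne']
      · simp [transp_color, SortIndex.lift]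

theorem SortIndex.exists_lift_eq (a : SortIndex (n + 1)) (h : a.j < Fin.last n) :
    ∃ b : SortIndex n, b.lift = a := by
  have hi : a.i < Fin.last n := by
    rcases a.valid with h' | ⟨h', _⟩
    · exact h'.trans h
    · exact h' ▸ h
  refine ⟨⟨a.i.castPred hi.ne, a.c, a.j.castPred h.ne, ?_⟩, ?_⟩
  · rcases a.valid with h' | ⟨h', hc, hj⟩
    · exact Or.inl (by simpa using h')
    · exact Or.inr ⟨by simp [h'], hc, by simpa using hj⟩
  · simp [SortIndex.lift]

theorem SortIndex.toPerm_of_last (a : SortIndex (n + 1)) (h : a.j = Fin.last n) :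
    a.toPerm = sorter a.i a.c := by
  rcases a.valid with h' | ⟨h', hc, hj⟩
  · rw [SortIndex.toPerm, if_neg h'.ne, sorter, if_neg (h ▸ h'.ne), h]
  · rw [SortIndex.toPerm, if_pos h', h', hc, h, sorter_last_one]

theorem SortIndex.weight_of_last (a : SortIndex (n + 1)) (h : a.j = Fin.last n) :
    a.weight = insertWeight a.i a.c := by
  rw [SortIndex.weight, insertWeight, h, Fin.val_last]
  split_ifs <;> omega

/-- `w` is a word `t_{x₁ j₁} ⋯ t_{x_k j_k}` with `j₁ < ⋯ < j_k` whose product is `π` and whose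
total weight is `m`. -/
def IsSortWord (π : SignedPerm n) (m : ℕ) (w : List (SortIndex n)) : Prop :=
  w.Pairwise (fun a b => a.j < b.j) ∧
    (w.map SortIndex.toPerm).prod = π ∧ (w.map SortIndex.weight).sum = m

theorem prod_map_toPerm_lift (w : List (SortIndex n)) :
    ((w.map SortIndex.lift).map SortIndex.toPerm).prod = (w.map SortIndex.toPerm).prod.embed := by
  induction w with
  | nil => simp [embed_one]
  | cons a w ih =>
    simp only [List.map_cons, List.prod_cons, SortIndex.toPerm_lift, embed_mul, ih]

theorem sum_map_weight_lift (w : List (SortIndex n)) :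
    ((w.map SortIndex.lift).map SortIndex.weight).sum = (w.map SortIndex.weight).sum := by
  simp only [List.map_map, Function.comp_def, SortIndex.weight_lift]

theorem exists_map_lift_eq (w : List (SortIndex (n + 1))) (h : ∀ a ∈ w, a.j < Fin.last n) :
    ∃ v : List (SortIndex n), v.map SortIndex.lift = w := by
  induction w with
  | nil => exact ⟨[], rfl⟩
  | cons a w ih =>
    obtain ⟨v, rfl⟩ := ih fun b hb => h b (List.mem_cons_of_mem _ hb)
    obtain ⟨b, rfl⟩ := a.exists_lift_eq (h _ List.mem_cons_self)
    exact ⟨b :: v, rfl⟩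

theorem pairwise_map_lift (w : List (SortIndex n)) :
    (w.map SortIndex.lift).Pairwise (fun a b => a.j < b.j) ↔ w.Pairwise fun a b => a.j < b.j := by
  rw [List.pairwise_map]
  simp [SortIndex.lift]

theorem insertWeight_last_zero : insertWeight (Fin.last n) 0 = 0 := by simp [insertWeight]

/-- In a sorting word at most one factor involves the largest letter, and it comes last. Uniqueness
for the inserting family identifies this factor with `sorter i c`, the rest being a word for `π`. -/
theorem exists_isSortWord_mul_sorter [NeZero n] (π : SignedPerm n) (i : Fin (n + 1)) (c : ZMod 2)
    (m : ℕ) : (∃ w, IsSortWord (π.embed * sorter i c) m w) ↔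
      ∃ k, (∃ w, IsSortWord π k w) ∧ m = k + insertWeight i c := by
  constructor
  · rintro ⟨w, hw, hprod, hsum⟩
    -- A word without a factor for the largest letter is treated as ending in `sorter (Fin.last n) 0
    -- = 1`, of weight 0, so that all cases take this form.
    have lifted : ∀ v : List (SortIndex (n + 1)), (∀ a ∈ v, a.j < Fin.last n) →
        v.Pairwise (fun a b => a.j < b.j) → ∀ (j : Fin (n + 1)) (d : ZMod 2),
        (v.map SortIndex.toPerm).prod * sorter j d = π.embed * sorter i c →
        (v.map SortIndex.weight).sum + insertWeight j d = m →
        ∃ k, (∃ w, IsSortWord π k w) ∧ m = k + insertWeight i c := by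
      intro v hv hpw j d hp hs
      obtain ⟨v, rfl⟩ := exists_map_lift_eq v hv
      rw [prod_map_toPerm_lift] at hp
      rw [sum_map_weight_lift] at hs
      obtain ⟨h1, rfl, rfl⟩ := isInserting_sorter.mul_injective hp
      exact ⟨_, ⟨v, (pairwise_map_lift v).1 hpw, h1, rfl⟩, hs.symm⟩
    induction w using List.reverseRecOn with
    | nil =>
      exact lifted [] (by simp) List.Pairwise.nil (Fin.last n) 0
        (by rw [sorter_last_zero, mul_one, hprod]) (by rw [insertWeight_last_zero, add_zero, hsum])
    | append_singleton w a _ =>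
      have hpw := List.pairwise_append.1 hw
      have hlt : ∀ b ∈ w, b.j < a.j := fun b hb => hpw.2.2 b hb a (List.mem_singleton_self a)
      by_cases ha : a.j = Fin.last n
      · refine lifted w (fun b hb => ha ▸ hlt b hb) hpw.1 a.i a.c ?_ ?_
        · rw [← hprod, ← a.toPerm_of_last ha]
          simp
        · rw [← hsum, ← a.weight_of_last ha]
          simp
      · have ha' := lt_of_le_of_ne (Fin.le_last _) ha
        refine lifted (w ++ [a]) ?_ hw (Fin.last n) 0
          (by rw [sorter_last_zero, mul_one, hprod])
          (by rw [insertWeight_last_zero, add_zero, hsum])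
        intro b hb
        rcases List.mem_append.1 hb with hb | hb
        · exact (hlt b hb).trans ha'
        · rwa [List.mem_singleton.1 hb]
  · rintro ⟨k, ⟨w, hw, rfl, rfl⟩, rfl⟩
    by_cases h : i = Fin.last n ∧ c = 0
    · obtain ⟨rfl, rfl⟩ := h
      refine ⟨w.map SortIndex.lift, (pairwise_map_lift w).2 hw, ?_, ?_⟩
      · rw [prod_map_toPerm_lift, sorter_last_zero, mul_one]
      · rw [sum_map_weight_lift, insertWeight_last_zero, add_zero]
    · let a : SortIndex (n + 1) := ⟨i, c, Fin.last n, by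
        rcases (Fin.le_last i).lt_or_eq with hi | hi
        · exact Or.inl hi
        · refine Or.inr ⟨hi, (zmod_two_cases c).resolve_left fun hc => h ⟨hi, hc⟩, ?_⟩
          simpa using NeZero.pos n⟩
      refine ⟨w.map SortIndex.lift ++ [a], ?_, ?_, ?_⟩
      · rw [List.pairwise_append]
        refine ⟨(pairwise_map_lift w).2 hw, List.pairwise_singleton _ _, ?_⟩
        intro x hx y hy
        obtain ⟨b, -, rfl⟩ := List.mem_map.1 hx
        rw [List.mem_singleton.1 hy]
        exact Fin.castSucc_lt_last _
      · rw [List.map_append, List.prod_append, prod_map_toPerm_lift, List.map_singleton,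
          List.prod_singleton, a.toPerm_of_last rfl]
      · rw [List.map_append, List.sum_append, sum_map_weight_lift, List.map_singleton,
          List.sum_singleton, a.weight_of_last rfl]

theorem sorD_eq_of_forall {π : SignedPerm n} {k : ℕ}
    (h : ∀ m, (∃ w, IsSortWord π m w) ↔ m = k) : sorD π = k := by
  have : {m | ∃ w, IsSortWord π m w} = {k} := Set.ext h
  exact (congrArg sInf this).trans (csInf_singleton k)

theorem eq_one_of_isEven {π : SignedPerm 1} (hπ : π.IsEven) : π = 1 := by
  rw [isEven_iff, Fin.sum_univ_one] at hπ
  ext i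
  · exact congrArg Fin.val (Subsingleton.elim _ _)
  · rw [Subsingleton.elim i 0, hπ, one_color]

instance : IsEmpty (SortIndex 1) :=
  ⟨fun a => by
    rcases a.valid with h | ⟨-, -, h⟩
    · exact h.ne (Subsingleton.elim _ _)
    · omega⟩

theorem exists_isSortWord_iff_one (m : ℕ) :
    (∃ w, IsSortWord (1 : SignedPerm 1) m w) ↔ m = 0 := by
  constructor
  · rintro ⟨w, -, -, rfl⟩
    rw [List.eq_nil_of_length_eq_zero (l := w)]
    · rfl
    · cases w with
      | nil => rfl
      | cons a w => exact isEmptyElim a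
  · rintro rfl
    exact ⟨[], List.Pairwise.nil, rfl, rfl⟩

/-- The set of weights of sorting words is a singleton, so the infimum defining `sorD` is an actual
weight and involves no choice. -/
theorem exists_isSortWord_iff_eq_sorD (π : SignedPerm (n + 1)) (hπ : π.IsEven) (m : ℕ) :
    (∃ w, IsSortWord π m w) ↔ m = sorD π := by
  suffices h : ∃ k, ∀ m, (∃ w, IsSortWord π m w) ↔ m = k by
    obtain ⟨k, hk⟩ := h
    rw [sorD_eq_of_forall hk, hk]
  clear m
  induction n with
  | zero =>
    rw [eq_one_of_isEven hπ]
    exact ⟨0, exists_isSortWord_iff_one⟩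
  | succ n ih =>
    obtain ⟨τ, i, c, rfl⟩ := isInserting_sorter.exists_mul_eq π
    obtain ⟨k, hk⟩ := ih τ ((isInserting_sorter.isEven_mul τ i c).1 hπ)
    refine ⟨k + insertWeight i c, fun m => ?_⟩
    simp [exists_isSortWord_mul_sorter, hk]

theorem sorD_mul_sorter (π : SignedPerm (n + 1)) (hπ : π.IsEven) (i : Fin (n + 2)) (c : ZMod 2) :
    sorD (π.embed * sorter i c) = sorD π + insertWeight i c := by
  refine sorD_eq_of_forall fun m => ?_
  simp [exists_isSortWord_mul_sorter, exists_isSortWord_iff_eq_sorD π hπ]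

theorem sorD_one : sorD (1 : SignedPerm 1) = 0 := sorD_eq_of_forall exists_isSortWord_iff_one

end SortingIndex

/-! ### Cycles and their colour sums. -/

section Cycles

/-- Lying in a common cycle is the smallest equivalence relation linking each `x` to `σ x`. -/
theorem sameCycle_induction {α : Type*} [Finite α] {σ : Equiv.Perm α} {r : α → α → Prop}
    (hr : Equivalence r) (h : ∀ x, r x (σ x)) {x y : α} (hxy : σ.SameCycle x y) : r x y := by
  obtain ⟨k, rfl⟩ := hxy.exists_nat_pow_eq
  induction k with
  | zero => exact hr.refl x
  | succ k ih =>
    rw [pow_succ', Equiv.Perm.mul_apply]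
    exact hr.trans (ih ⟨k, by simp⟩) (h _)

theorem sameCycle_embedPerm_castSucc (σ : Equiv.Perm (Fin n)) (x y : Fin n) :
    (embedPerm σ).SameCycle x.castSucc y.castSucc ↔ σ.SameCycle x y := by
  have hs : ∀ k : ℕ, (embedPerm σ ^ k) x.castSucc = ((σ ^ k) x).castSucc := by
    intro k
    induction k with
    | zero => rfl
    | succ k ih => rw [pow_succ', Equiv.Perm.mul_apply, ih, embedPerm_castSucc, pow_succ',
        Equiv.Perm.mul_apply]
  constructor
  · intro h
    obtain ⟨k, hk⟩ := h.exists_nat_pow_eq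
    rw [hs] at hk
    exact ⟨k, by simpa using hk⟩
  · intro h
    obtain ⟨k, rfl⟩ := h.exists_nat_pow_eq
    exact ⟨k, by simpa using hs k⟩

theorem sameCycle_embedPerm_last (σ : Equiv.Perm (Fin n)) (x : Fin (n + 1)) :
    (embedPerm σ).SameCycle (Fin.last n) x ↔ x = Fin.last n := by
  constructor
  · exact fun h => (h.eq_of_left (embedPerm_last σ)).symm
  · rintro rfl
    rfl

section InsertIntoCycle

variable (σ : Equiv.Perm (Fin n)) (a : Fin n)

/-- The permutation obtained by inserting the last letter after `a` in its cycle. -/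
def insertAfter : Equiv.Perm (Fin (n + 1)) :=
  embedPerm σ * Equiv.swap a.castSucc (Fin.last n)

theorem insertAfter_last : insertAfter σ a (Fin.last n) = (σ a).castSucc := by
  simp [insertAfter]

theorem insertAfter_castSucc_self : insertAfter σ a a.castSucc = Fin.last n := by
  simp [insertAfter]

theorem insertAfter_castSucc_of_ne {x : Fin n} (hx : x ≠ a) :
    insertAfter σ a x.castSucc = (σ x).castSucc := by
  rw [insertAfter, Equiv.Perm.mul_apply, Equiv.swap_apply_of_ne_of_ne, embedPerm_castSucc]
  · simpa using hx
  · exact (Fin.castSucc_lt_last x).ne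

theorem sameCycle_insertAfter_last :
    (insertAfter σ a).SameCycle a.castSucc (Fin.last n) :=
  ⟨1, by simp [insertAfter_castSucc_self]⟩

theorem sameCycle_insertAfter_castSucc (x y : Fin n) :
    (insertAfter σ a).SameCycle x.castSucc y.castSucc ↔ σ.SameCycle x y := by
  constructor
  -- Contract the new letter onto its predecessor `a`; each step of the enlarged cycle then stays
  -- within a cycle of `σ`.
  · let ρ : Fin (n + 1) → Fin n := Fin.lastCases a id
    have hρ : ∀ x y, (insertAfter σ a).SameCycle x y → σ.SameCycle (ρ x) (ρ y) := by
      refine fun x y => sameCycle_induction (r := fun x y => σ.SameCycle (ρ x) (ρ y))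
        ⟨fun _ => Equiv.Perm.SameCycle.refl _ _, Equiv.Perm.SameCycle.symm,
          Equiv.Perm.SameCycle.trans⟩ fun z => ?_
      refine Fin.lastCases ?_ (fun z => ?_) z
      · rw [insertAfter_last]
        simpa [ρ] using Equiv.Perm.SameCycle.refl σ a
      · by_cases hz : z = a
        · rw [hz, insertAfter_castSucc_self]
          simpa [ρ] using Equiv.Perm.SameCycle.refl σ a
        · rw [insertAfter_castSucc_of_ne σ a hz]
          simpa [ρ] using Equiv.Perm.SameCycle.refl σ z
    intro h
    simpa [ρ] using hρ _ _ h
  · refine sameCycle_induction (r := fun x y : Fin n =>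
      (insertAfter σ a).SameCycle x.castSucc y.castSucc)
        ⟨fun _ => Equiv.Perm.SameCycle.refl _ _, Equiv.Perm.SameCycle.symm,
          Equiv.Perm.SameCycle.trans⟩ fun z => ?_
    by_cases hz : z = a
    -- The step from `a` to `σ a` now takes the detour through the new letter.
    · refine ⟨2, ?_⟩
      rw [show (2 : ℤ) = 1 + 1 from rfl, zpow_add, zpow_one, hz, Equiv.Perm.mul_apply, insertAfter_castSucc_self, insertAfter_last]
    · exact ⟨1, by simp [insertAfter_castSucc_of_ne σ a hz]⟩

theorem sameCycle_insertAfter_castSucc_last (x : Fin n) :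
    (insertAfter σ a).SameCycle x.castSucc (Fin.last n) ↔ σ.SameCycle x a := by
  rw [← sameCycle_insertAfter_castSucc σ a x a]
  exact ⟨fun h => h.trans (sameCycle_insertAfter_last σ a).symm,
    fun h => h.trans (sameCycle_insertAfter_last σ a)⟩

end InsertIntoCycle

theorem mul_sorter_castSucc_perm (π : SignedPerm n) (a : Fin n) (c : ZMod 2) :
    (π.embed * sorter a.castSucc c).perm = insertAfter π.perm a := by
  rw [mul_perm, sorter_perm, insertAfter, embed_perm]

theorem mul_sorter_last_perm (π : SignedPerm n) (c : ZMod 2) :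
    (π.embed * sorter (Fin.last n) c).perm = embedPerm π.perm := by
  rw [mul_perm, sorter_last_perm, mul_one, embed_perm]

theorem mem_Cyc (t : ZMod 2) (π : SignedPerm n) (x : ℕ) : x ∈ Cyc t π ↔
    ∃ i : Fin n, ((∀ j, π.perm.SameCycle i j → i ≤ j) ∧
      (∑ j, if π.perm.SameCycle i j then π.color j else 0) = t) ∧ (i : ℕ) + 1 = x := by
  simp [Cyc, Finset.sum_filter]

/-- The positions `a` and last lie in one cycle and carry the colours `c` and `π.color a + c`. Their
sum is `π.color a`, the former contribution of `a`. -/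
theorem sum_sameCycle_mul_sorter_castSucc (π : SignedPerm n) (a x : Fin n) (c : ZMod 2) :
    (∑ j, if (π.embed * sorter a.castSucc c).perm.SameCycle x.castSucc j then
      (π.embed * sorter a.castSucc c).color j else 0) =
      ∑ j, if π.perm.SameCycle x j then π.color j else 0 := by
  have hcol : ∀ j : Fin n, (π.embed * sorter a.castSucc c).color j.castSucc =
      if j = a then c else π.color j := by
    intro j
    by_cases hj : j = a
    · simp [mul_color, sorter_castSucc, transp_perm, transp_color, hj]
    · rw [mul_color, sorter_castSucc, transp_perm, transp_color,
        Equiv.swap_apply_of_ne_of_ne (by simpa using hj) (Fin.castSucc_lt_last j).ne]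
      simp [hj, (Fin.castSucc_lt_last j).ne]
  have hlast : (π.embed * sorter a.castSucc c).color (Fin.last n) = π.color a + c := by
    simp [mul_color, sorter_castSucc, transp_perm, transp_color]
  rw [Fin.sum_univ_castSucc]
  simp only [hcol, hlast, mul_sorter_castSucc_perm, sameCycle_insertAfter_castSucc,
    sameCycle_insertAfter_castSucc_last]
  rw [← Finset.add_sum_erase _ _ (Finset.mem_univ a),
    ← Finset.add_sum_erase _ (fun j => if π.perm.SameCycle x j then π.color j else 0)
      (Finset.mem_univ a)]
  have : ∀ j ∈ Finset.univ.erase a, (if π.perm.SameCycle x j then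
      if j = a then c else π.color j else 0) = if π.perm.SameCycle x j then π.color j else 0 := by
    intro j hj
    rw [if_neg (Finset.ne_of_mem_erase hj)]
  rw [Finset.sum_congr rfl this, if_pos rfl]
  split_ifs
  · linear_combination CharTwo.add_self_eq_zero c
  · ring

/-- The new letter is the minimum of its cycle only when it is a fixed point. In that case with `c =
1`, the compensating flip at position 0 affects only the cycle of the letter 1, excluded by `x ≠ 1`.
-/
theorem mem_Cyc_mul_sorter [NeZero n] (π : SignedPerm n) (i : Fin (n + 1)) (c t : ZMod 2) {x : ℕ}
    (hx : x ≠ 1) : x ∈ Cyc t (π.embed * sorter i c) ↔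
      x ∈ Cyc t π ∨ (i = Fin.last n ∧ c = t ∧ x = n + 1) := by
  rw [mem_Cyc, mem_Cyc, Fin.exists_fin_succ']
  refine Fin.lastCases ?_ (fun a => ?_) i
  · have hcol : ∀ k : Fin n, (k : ℕ) ≠ 0 →
        (π.embed * sorter (Fin.last n) c).color k.castSucc = π.color k := by
      intro k hk
      rcases zmod_two_cases c with rfl | rfl
      · rw [sorter_last_zero, mul_one, embed_color_castSucc]
      · rw [sorter_last_one, mul_color]
        rw [sorter_last_one.symm, sorter_last_perm, sorter_last_one, signFlip_color, if_neg]
        · simp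
        · rintro (h | h)
          · exact hk h
          · exact (Fin.castSucc_lt_last k).ne h
    refine or_congr (exists_congr fun k => ?_) ?_
    · by_cases hk : (k : ℕ) = 0
      · have : (k : ℕ) + 1 ≠ x := by omega
        simp [this]
      rw [Fin.forall_fin_succ', Fin.sum_univ_castSucc]
      simp only [mul_sorter_last_perm, sameCycle_embedPerm_castSucc, Fin.castSucc_le_castSucc_iff,
        Fin.le_last, implies_true, and_true, Equiv.Perm.sameCycle_comm (x := k.castSucc)
          (y := Fin.last n), sameCycle_embedPerm_last, (Fin.castSucc_lt_last k).ne, if_false,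
        add_zero, Fin.val_castSucc]
      refine and_congr_left' (and_congr_right fun hmin => ?_)
      rw [Finset.sum_congr rfl]
      intro j _
      split_ifs with hj
      -- The minimum `k` of the cycle is not 0, so the cycle avoids the position whose colour may
      -- have been flipped.
      · exact hcol j (by have := hmin j hj; rw [Fin.le_def] at this; omega)
      · rfl
    · simp only [mul_sorter_last_perm, sameCycle_embedPerm_last, Finset.sum_ite_eq',
        Finset.mem_univ, if_true, isInserting_sorter.mul_color_self, Fin.val_last]
      constructor
      · rintro ⟨⟨-, h⟩, h'⟩
        exact ⟨trivial, h, h'.symm⟩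
      · rintro ⟨-, h, h'⟩
        exact ⟨⟨fun j hj => hj.ge, h⟩, h'.symm⟩
  · have h1 : ¬ (a.castSucc = Fin.last n ∧ c = t ∧ x = n + 1) :=
      fun h => (Fin.castSucc_lt_last a).ne h.1
    have h2 : ¬ ∀ j, (π.embed * sorter a.castSucc c).perm.SameCycle (Fin.last n) j →
        Fin.last n ≤ j := by
      intro h
      rw [mul_sorter_castSucc_perm] at h
      exact (h _ (sameCycle_insertAfter_last π.perm a).symm).not_gt (Fin.castSucc_lt_last a)
    simp only [h1, h2, false_and, or_false, sum_sameCycle_mul_sorter_castSucc]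
    refine exists_congr fun k => ?_
    rw [Fin.forall_fin_succ']
    simp only [mul_sorter_castSucc_perm, sameCycle_insertAfter_castSucc,
      Fin.castSucc_le_castSucc_iff, Fin.le_last, implies_true, and_true, Fin.val_castSucc]

end Cycles

/-! ### Left-to-right minima along the orbit of the first letter. -/

section LeftToRightMinima

open Relation

/-- `v` is a left-to-right minimum of the word `σ(0) σ²(0) ⋯`: the orbit reaches it from `σ(0)`
through letters that are larger than `v`. -/
def IsOrbitMin [NeZero n] (σ : Equiv.Perm (Fin n)) (v : Fin n) : Prop :=
  ReflTransGen (fun x y => y = σ x ∧ v < x) (σ 0) v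

theorem act_iterate_fst (π : SignedPerm n) (k : ℕ) (x : Fin n × ZMod 2) :
    ((π.act)^[k] x).1 = (π.perm)^[k] x.1 := by
  induction k with
  | zero => rfl
  | succ k ih => rw [Function.iterate_succ_apply', Function.iterate_succ_apply', ← ih]; rfl

theorem reflTransGen_orbit_iff (σ : Equiv.Perm (Fin n)) (v x y : Fin n) :
    ReflTransGen (fun x y => y = σ x ∧ v < x) x y ↔
      ∃ k : ℕ, y = σ^[k] x ∧ ∀ m < k, v < σ^[m] x := by
  constructor
  · intro h
    induction h with
    | refl => exact ⟨0, rfl, by simp⟩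
    | tail _ hbc ih =>
      obtain ⟨k, rfl, hk⟩ := ih
      obtain ⟨rfl, hlt⟩ := hbc
      refine ⟨k + 1, (Function.iterate_succ_apply' _ _ _).symm, fun m hm => ?_⟩
      rcases Nat.lt_succ_iff_lt_or_eq.1 hm with h | rfl
      · exact hk m h
      · exact hlt
  · rintro ⟨k, rfl, hk⟩
    induction k with
    | zero => exact ReflTransGen.refl
    | succ k ih =>
      exact (ih fun m hm => hk m (by omega)).tail
        ⟨Function.iterate_succ_apply' _ _ _, hk k (by omega)⟩

/-- The path starts at `σ 0`, so its `k` steps correspond to the exponent `k + 1` in the word.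
Reachability lets paths be transported through the insertion of a letter without tracking exponents.
-/
theorem isOrbitMin_iff [NeZero n] (σ : Equiv.Perm (Fin n)) (v : Fin n) :
    IsOrbitMin σ v ↔ ∃ k : ℕ, 1 ≤ k ∧ v = σ^[k] 0 ∧ ∀ m : ℕ, 1 ≤ m → m < k → v < σ^[m] 0 := by
  rw [IsOrbitMin, reflTransGen_orbit_iff]
  constructor
  · rintro ⟨k, hk, h⟩
    refine ⟨k + 1, by omega, hk, fun m hm hmk => ?_⟩
    obtain ⟨m, rfl⟩ := Nat.exists_eq_add_of_le' hm
    exact h m (by omega)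
  · rintro ⟨k, hk, h1, h2⟩
    obtain ⟨k, rfl⟩ := Nat.exists_eq_add_of_le' hk
    exact ⟨k, h1, fun m hm => h2 (m + 1) (by omega) (by omega)⟩

open Classical in
theorem lmic_eq [NeZero n] (π : SignedPerm n) :
    lmic π = ∑ v, if IsOrbitMin π.perm v then 1 else 0 := by
  rw [lmic, ← Finset.card_filter]
  refine Finset.card_bij (fun x _ => x.1) ?_ ?_ ?_
  · intro x hx
    simp only [Lmic, Finset.mem_filter, Finset.mem_univ, true_and, act_iterate_fst] at hx
    obtain ⟨k, hk, rfl, h⟩ := hx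
    simp only [Finset.mem_filter, Finset.mem_univ, true_and, isOrbitMin_iff, act_iterate_fst] at *
    exact ⟨k, hk, rfl, h⟩
  · intro x hx y hy hxy
    simp only [Lmic, Finset.mem_filter, Finset.mem_univ, true_and] at hx hy
    obtain ⟨k, hk, hxk, h⟩ := hx
    obtain ⟨l, hl, hyl, h'⟩ := hy
    rcases lt_trichotomy k l with hkl | rfl | hkl
    · have := h' k hk hkl
      rw [← hxk, hxy] at this
      exact absurd this (lt_irrefl _)
    · rw [hxk, hyl]
    · have := h l hl hkl
      rw [← hyl, hxy] at this
      exact absurd this (lt_irrefl _)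
  · intro v hv
    simp only [Finset.mem_filter, Finset.mem_univ, true_and, isOrbitMin_iff] at hv
    obtain ⟨k, hk, hvk, h⟩ := hv
    refine ⟨(π.act)^[k] (0, 0), ?_, ?_⟩
    · simp only [Lmic, Finset.mem_filter, Finset.mem_univ, true_and, act_iterate_fst]
      exact ⟨k, hk, rfl, fun m hm hmk => hvk ▸ h m hm hmk⟩
    · rw [act_iterate_fst, hvk]

theorem isOrbitMin_last [NeZero n] (σ : Equiv.Perm (Fin (n + 1))) :
    IsOrbitMin σ (Fin.last n) ↔ σ 0 = Fin.last n := by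
  constructor
  · intro h
    rcases ReflTransGen.cases_head h with h | ⟨_, ⟨_, h⟩, _⟩
    · exact h
    · exact absurd h (Fin.le_last _).not_gt
  · intro h
    rw [IsOrbitMin, h]

theorem isOrbitMin_embedPerm_castSucc [NeZero n] (σ : Equiv.Perm (Fin n)) (v : Fin n) :
    IsOrbitMin (embedPerm σ) v.castSucc ↔ IsOrbitMin σ v := by
  constructor
  · intro h
    -- The value at the last letter is arbitrary: that letter is fixed, so every step from it is
    -- trivial.
    let ρ : Fin (n + 1) → Fin n := Fin.lastCases 0 id
    have := ReflTransGen.lift' (p := fun x y => y = σ x ∧ v < x) ρ ?_ _ _ h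
    · rw [Function.onFun, ← Fin.castSucc_zero, embedPerm_castSucc] at this
      simpa [ρ, IsOrbitMin] using this
    · intro x y
      refine Fin.lastCases ?_ (fun x => ?_) x
      · rintro ⟨rfl, -⟩
        rw [embedPerm_last]
      · rintro ⟨rfl, hlt⟩
        exact ReflTransGen.single ⟨by simp [ρ], by simpa [ρ] using hlt⟩
  · intro h
    rw [IsOrbitMin, ← Fin.castSucc_zero, embedPerm_castSucc]
    refine ReflTransGen.lift Fin.castSucc ?_ _ _ h
    rintro x y ⟨rfl, hlt⟩
    exact ⟨by simp, by simpa using hlt⟩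

/-- The inserted letter exceeds every old `v`, so passing through it never blocks a path. -/
theorem isOrbitMin_insertAfter_castSucc [NeZero n] (σ : Equiv.Perm (Fin n)) (a v : Fin n) :
    IsOrbitMin (insertAfter σ a) v.castSucc ↔ IsOrbitMin σ v := by
  constructor
  · intro h
    -- The new letter contracts onto its successor, not its predecessor: the condition `v < a`
    -- accompanies the step from `a` into the new letter, so that step must become `a ↦ σ a` and the
    -- step out of it the empty path.
    let ρ : Fin (n + 1) → Fin n := Fin.lastCases (σ a) id
    have hρ : ∀ x, ρ (insertAfter σ a x.castSucc) = σ x := by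
      intro x
      by_cases hx : x = a
      · rw [hx, insertAfter_castSucc_self]
        simp [ρ]
      · rw [insertAfter_castSucc_of_ne σ a hx]
        simp [ρ]
    have := ReflTransGen.lift' (p := fun x y => y = σ x ∧ v < x) ρ ?_ _ _ h
    · rw [Function.onFun, ← Fin.castSucc_zero, hρ] at this
      simpa [ρ, IsOrbitMin] using this
    · intro x y
      refine Fin.lastCases ?_ (fun x => ?_) x
      · rintro ⟨rfl, -⟩
        rw [insertAfter_last, Function.onFun]
        simp only [ρ, Fin.lastCases_last, Fin.lastCases_castSucc, id]
        exact ReflTransGen.refl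
      · rintro ⟨rfl, hlt⟩
        rw [Function.onFun, hρ]
        exact ReflTransGen.single ⟨by simp [ρ], by simpa [ρ] using hlt⟩
  · intro h
    have hstep : ∀ x : Fin n, ReflTransGen
        (fun x y => y = insertAfter σ a x ∧ v.castSucc < x)
        (insertAfter σ a x.castSucc) (σ x).castSucc := by
      intro x
      by_cases hx : x = a
      · rw [hx, insertAfter_castSucc_self]
        exact ReflTransGen.single ⟨(insertAfter_last σ a).symm, Fin.castSucc_lt_last v⟩
      · rw [insertAfter_castSucc_of_ne σ a hx]
    rw [IsOrbitMin, ← Fin.castSucc_zero]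
    refine (hstep 0).trans (ReflTransGen.lift' Fin.castSucc ?_ _ _ h)
    rintro x y ⟨rfl, hlt⟩
    exact (hstep x).head ⟨rfl, by simpa using hlt⟩

theorem lmic_mul_sorter [NeZero n] (π : SignedPerm n) (i : Fin (n + 1)) (c : ZMod 2) :
    lmic (π.embed * sorter i c) = lmic π + if i = 0 then 1 else 0 := by
  classical
  rw [lmic_eq, lmic_eq, Fin.sum_univ_castSucc]
  congr 1
  · refine Finset.sum_congr rfl fun v _ => ?_
    congr 1
    apply propext
    refine Fin.lastCases ?_ (fun a => ?_) i
    · rw [mul_sorter_last_perm, isOrbitMin_embedPerm_castSucc]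
    · rw [mul_sorter_castSucc_perm, isOrbitMin_insertAfter_castSucc]
  · congr 1
    apply propext
    rw [isOrbitMin_last, ← isInserting_sorter.mul_perm_self π i c, Equiv.apply_eq_iff_eq, eq_comm]

end LeftToRightMinima

/-! ### The common factor for both weights. -/

section InsertFactor

variable {R : Type*} [CommSemiring R] (q u : R) (t s : ℕ → R)

/-- The factor contributed by inserting the last letter `n + 1` with colour `c` at position `i`. -/
def insertFactor (i : Fin (n + 1)) (c : ZMod 2) : R :=
  q ^ insertWeight i c * (if i = 0 then u else 1) *
    if i = Fin.last n then if c = 0 then t (n + 1) else s (n + 1) else 1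

/-- Shared by the pairs `Rmil` and `Cyc`: adjoining or deleting 1 makes membership of 1 irrelevant,
so hypotheses for `x ≠ 1` suffice. -/
theorem prod_union_one_mul_prod_sdiff_one {A B A' B' : Finset ℕ} {i : Fin (n + 1)} {c : ZMod 2}
    (hA : ∀ x ≠ 1, x ∈ A' ↔ x ∈ A ∨ (i = Fin.last n ∧ c = 0 ∧ x = n + 1))
    (hB : ∀ x ≠ 1, x ∈ B' ↔ x ∈ B ∨ (i = Fin.last n ∧ c = 1 ∧ x = n + 1))
    (hn : n ≠ 0) (hAn : n + 1 ∉ A) (hBn : n + 1 ∉ B) :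
    (∏ x ∈ A' ∪ {1}, t x) * (∏ x ∈ B' \ {1}, s x) =
      (∏ x ∈ A ∪ {1}, t x) * (∏ x ∈ B \ {1}, s x) *
        if i = Fin.last n then if c = 0 then t (n + 1) else s (n + 1) else 1 := by
  have union_eq : ∀ {D : Finset ℕ}, (∀ x ≠ 1, x ∈ A' ↔ x ∈ D) → A' ∪ {1} = D ∪ {1} := by
    intro D h
    ext x
    by_cases hx : x = 1 <;> simp [hx, h]
  have sdiff_eq : ∀ {D : Finset ℕ}, (∀ x ≠ 1, x ∈ B' ↔ x ∈ D) → B' \ {1} = D \ {1} := by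
    intro D h
    ext x
    by_cases hx : x = 1 <;> simp [hx, h]
  by_cases hi : i = Fin.last n
  · rcases zmod_two_cases c with rfl | rfl
    · rw [union_eq (D := insert (n + 1) A) (by simpa [hi, or_comm] using hA),
        sdiff_eq (D := B) (by simpa [hi] using hB), Finset.insert_union,
        Finset.prod_insert (by simp [hAn, hn]), if_pos hi, if_pos rfl]
      ring
    · rw [union_eq (D := A) (by simpa [hi] using hA),
        sdiff_eq (D := insert (n + 1) B) (by simpa [hi, or_comm] using hB),
        Finset.insert_sdiff_of_notMem _ (by simp [hn]),
        Finset.prod_insert (by simp [hBn]), if_pos hi, if_neg one_ne_zero]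
      ring
  · rw [union_eq (D := A) (by simpa [hi] using hA), sdiff_eq (D := B) (by simpa [hi] using hB),
      if_neg hi, mul_one]

/-- The weight of `π` built from the length and the right-to-left minima. -/
noncomputable def lengthTerm (π : SignedPerm n) : R :=
  q ^ π.lengthD * u ^ π.lmin * (∏ i ∈ π.RmilPlus, t i) * (∏ i ∈ π.RmilMinus, s i)

/-- The weight of `π` built from the sorting index and the cycles. -/
noncomputable def sortTerm [NeZero n] (π : SignedPerm n) : R :=
  q ^ π.sorD * u ^ π.lmic * (∏ i ∈ π.CycPlus, t i) * (∏ i ∈ π.CycMinus, s i)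

/-- Evenness of `π` is needed to replace `lengthD` by `invD` on both sides. -/
theorem lengthTerm_mul_insertion [NeZero n] (π : SignedPerm n) (hπ : π.IsEven) (i : Fin (n + 1))
    (c : ZMod 2) : lengthTerm q u t s (π.embed * insertion i c) =
      lengthTerm q u t s π * insertFactor q u t s i c := by
  have hmem : ∀ d : ZMod 2, n + 1 ∉ Rmil d π := by
    intro d h
    obtain ⟨k, -, hk⟩ := (mem_Rmil d π _).1 h
    have := (π.perm k).isLt
    omega
  have h := prod_union_one_mul_prod_sdiff_one t s
    (fun x hx => mem_Rmil_mul_insertion π i c 0 hx)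
    (fun x hx => mem_Rmil_mul_insertion π i c 1 hx) (NeZero.ne n) (hmem 0) (hmem 1)
  rw [lengthTerm, lengthTerm, insertFactor, lengthD_eq_invD _ hπ,
    lengthD_eq_invD _ ((isInserting_insertion.isEven_mul π i c).2 hπ), invD_mul_insertion,
    lmin_mul_insertion, mul_assoc _ (∏ i ∈ RmilPlus _, t i), RmilPlus, RmilMinus, h, RmilPlus,
    RmilMinus, pow_add, pow_add]
  split_ifs <;> ring

theorem sortTerm_mul_sorter (π : SignedPerm (n + 1)) (hπ : π.IsEven) (i : Fin (n + 2))
    (c : ZMod 2) : sortTerm q u t s (π.embed * sorter i c) =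
      sortTerm q u t s π * insertFactor q u t s i c := by
  have hmem : ∀ d : ZMod 2, n + 1 + 1 ∉ Cyc d π := by
    intro d h
    obtain ⟨k, -, hk⟩ := (mem_Cyc d π _).1 h
    omega
  have h := prod_union_one_mul_prod_sdiff_one t s
    (fun x hx => mem_Cyc_mul_sorter π i c 0 hx)
    (fun x hx => mem_Cyc_mul_sorter π i c 1 hx) (NeZero.ne (n + 1)) (hmem 0) (hmem 1)
  rw [sortTerm, sortTerm, insertFactor, sorD_mul_sorter π hπ,
    lmic_mul_sorter, mul_assoc _ (∏ i ∈ CycPlus _, t i), CycPlus, CycMinus, h, CycPlus,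
    CycMinus, pow_add, pow_add]
  split_ifs <;> ring

theorem isEven_one : (1 : SignedPerm n).IsEven := by
  rw [isEven_iff]
  simp [one_color]

theorem lengthTerm_one : lengthTerm q u t s (1 : SignedPerm 1) = t 1 * u := by
  have h1 : lmin (1 : SignedPerm 1) = 1 := by decide
  have h2 : RmilPlus (1 : SignedPerm 1) = {1} := by decide
  have h3 : RmilMinus (1 : SignedPerm 1) = ∅ := by decide
  rw [lengthTerm, lengthD_eq_invD _ isEven_one, invD_one, h1, h2, h3]
  simp [mul_comm]

theorem sortTerm_one : sortTerm q u t s (1 : SignedPerm 1) = t 1 * u := by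
  have h1 : lmic (1 : SignedPerm 1) = 1 := by
    classical
    rw [lmic_eq, Fin.sum_univ_one, if_pos]
    exact Relation.ReflTransGen.refl
  have hC : ∀ d, Cyc d (1 : SignedPerm 1) ⊆ {1} := by
    intro d x hx
    obtain ⟨i, -, rfl⟩ := (mem_Cyc d _ x).1 hx
    simp
  have h2 : CycPlus (1 : SignedPerm 1) = {1} := Finset.union_eq_right.2 (hC 0)
  have h3 : CycMinus (1 : SignedPerm 1) = ∅ := Finset.sdiff_eq_empty_iff_subset.2 (hC 1)
  rw [sortTerm, sorD_one, h1, h2, h3]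
  simp [mul_comm]

end InsertFactor

/-! ### First admissible positions of letters. -/

section HIndex

theorem fits_of_truncShape_nonempty [NeZero n] {f : Fin (n + 1) → ℕ} (hf : Monotone f)
    (h : (restrictedD f).Nonempty) :
    (restrictedD (truncShape f)).Nonempty ∧ n + 1 ≤ f (Fin.last n) := by
  obtain ⟨π, hπ⟩ := h
  obtain ⟨τ, i, c, rfl⟩ := isInserting_sorter.exists_mul_eq π
  obtain ⟨h1, h2⟩ := (isInserting_sorter.mem_restrictedD_mul hf τ i c).1 hπ
  exact ⟨⟨τ, h1⟩, h2.trans (hf (Fin.le_last i))⟩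

/-- The largest letter can occupy any position whose bound admits it, the other positions being
filled by some `τ` fitting the truncated shape. By monotonicity these positions form a final
segment. -/
theorem hIndex_le_iff_of_last [NeZero n] {f : Fin (n + 1) → ℕ} (hf : Monotone f)
    (h : (restrictedD f).Nonempty) (i : Fin (n + 1)) :
    hIndex f (n + 1) ≤ (i : ℕ) + 1 ↔ n + 1 ≤ f i := by
  obtain ⟨⟨τ, hτ⟩, hlast⟩ := fits_of_truncShape_nonempty hf h
  have hτ' : τ.Fits (truncShape f) := (Finset.mem_filter.1 hτ).2.2
  have mem_iff : ∀ p, (∃ π : SignedPerm (n + 1), π.Fits f ∧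
      ∃ i : Fin (n + 1), (i : ℕ) + 1 = p ∧ (π.perm i : ℕ) + 1 = n + 1) ↔
      ∃ i : Fin (n + 1), (i : ℕ) + 1 = p ∧ n + 1 ≤ f i := by
    intro p
    constructor
    · rintro ⟨π, hπ, i, hi, hv⟩
      exact ⟨i, hi, hv ▸ hπ i⟩
    · rintro ⟨i, hi, hfi⟩
      refine ⟨τ.embed * sorter i 0, (isInserting_sorter.fits_mul hf τ i 0).2 ⟨hfi, hτ'⟩, i, hi, ?_⟩
      rw [isInserting_sorter.mul_perm_self, Fin.val_last]
  have hset : hIndex f (n + 1) = sInf {p | ∃ i : Fin (n + 1), (i : ℕ) + 1 = p ∧ n + 1 ≤ f i} :=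
    congrArg sInf (Set.ext mem_iff)
  rw [hset]
  constructor
  · intro hle
    obtain ⟨k, hk, hfk⟩ := Nat.sInf_mem
      (⟨_, Fin.last n, rfl, hlast⟩ :
        {p | ∃ i : Fin (n + 1), (i : ℕ) + 1 = p ∧ n + 1 ≤ f i}.Nonempty)
    refine hfk.trans (hf ?_)
    rw [Fin.le_def]
    omega
  · intro hfi
    exact Nat.sInf_le ⟨i, rfl, hfi⟩

theorem exists_fits_of_hIndex {f : Fin n → ℕ} {σ : SignedPerm n} (hσ : σ.Fits f) {j : ℕ}
    (hj : 1 ≤ j) (hjn : j ≤ n) : ∃ π : SignedPerm n, π.Fits f ∧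
      ∃ i : Fin n, (i : ℕ) + 1 = hIndex f j ∧ (π.perm i : ℕ) + 1 = j := by
  refine Nat.sInf_mem (s := {p | ∃ π : SignedPerm n, π.Fits f ∧
    ∃ i : Fin n, (i : ℕ) + 1 = p ∧ (π.perm i : ℕ) + 1 = j})
    ⟨_, σ, hσ, σ.perm.symm ⟨j - 1, by omega⟩, rfl, ?_⟩
  rw [Equiv.apply_symm_apply]
  exact Nat.sub_add_cancel hj

theorem hIndex_le {f : Fin n → ℕ} {π : SignedPerm n} (hπ : π.Fits f) (i : Fin n) :
    hIndex f ((π.perm i : ℕ) + 1) ≤ (i : ℕ) + 1 :=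
  Nat.sInf_le ⟨π, hπ, i, rfl, rfl⟩

/-- Deleting the largest letter through `sorter` never moves another letter to the right, and
appending it at the end moves none. Hence the earliest positions of the old letters agree. -/
theorem hIndex_truncShape [NeZero n] {f : Fin (n + 1) → ℕ} (hf : Monotone f)
    (h : (restrictedD f).Nonempty) {j : ℕ} (hj : 1 ≤ j) (hjn : j ≤ n) :
    hIndex (truncShape f) j = hIndex f j := by
  obtain ⟨⟨τ, hτ⟩, hlast⟩ := fits_of_truncShape_nonempty hf h
  have hτ' : τ.Fits (truncShape f) := (Finset.mem_filter.1 hτ).2.2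
  apply le_antisymm
  · obtain ⟨π, hπ, i, hi, rfl⟩ := exists_fits_of_hIndex (Finset.mem_filter.1 h.choose_spec).2.2
      hj (hjn.trans (Nat.le_succ n))
    rw [← hi]
    obtain ⟨ρ, a, c, rfl⟩ := isInserting_sorter.exists_mul_eq π
    have hia : i ≠ a := by
      rintro rfl
      rw [isInserting_sorter.mul_perm_self, Fin.val_last] at hjn
      omega
    have hne : (sorter a c).perm i ≠ Fin.last n := fun h' =>
      hia ((sorter a c).perm.injective (h'.trans (isInserting_sorter.perm_self a c).symm))
    obtain ⟨k, hk⟩ : ∃ k : Fin n, k.castSucc = (sorter a c).perm i :=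
      ⟨((sorter a c).perm i).castPred hne, by simp⟩
    have hki : (k : ℕ) ≤ i := by
      have := sorter_perm_le a c i hia
      rwa [← hk] at this
    rw [mul_perm, Equiv.Perm.mul_apply, ← hk, embed_perm, embedPerm_castSucc, Fin.val_castSucc]
    exact (hIndex_le ((isInserting_sorter.fits_mul hf ρ a c).1 hπ).2 k).trans (by omega)
  · obtain ⟨π, hπ, i, hi, rfl⟩ := exists_fits_of_hIndex hτ' hj hjn
    rw [← hi]
    have hfit := (isInserting_sorter.fits_mul hf π (Fin.last n) 0).2 ⟨hlast, hπ⟩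
    rw [sorter_last_zero, mul_one] at hfit
    simpa using hIndex_le hfit i.castSucc

end HIndex

/-! ### Assembling the product formula. -/

section GeneratingFunction

variable {R : Type*} [CommSemiring R] (q u : R) (t s : ℕ → R)

/-- The last position yields the `t` and `s` terms, the others the powers of `q`, with `u` at the
first. The index set is the final segment starting at `hIndex`, with `i : Fin` shifted to the
1-based position `i + 1`. -/
theorem sum_insertFactor {f : Fin (n + 2) → ℕ} (hf : Monotone f)
    (h : (restrictedD f).Nonempty) :
    ∑ i ∈ Finset.univ.filter (fun i => n + 2 ≤ f i),
        (insertFactor q u t s i 0 + insertFactor q u t s i 1) =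
      t (n + 2) + (∑ i ∈ Finset.Ico (hIndex f (n + 2)) (n + 2),
        (if i = 1 then u else 1) * (q ^ (n + 2 - i) + q ^ (n + 2 + i - 2))) +
        s (n + 2) * q ^ (2 * (n + 2) - 2) := by
  have hlast := (fits_of_truncShape_nonempty hf h).2
  have hpos : 1 ≤ hIndex f (n + 2) := by
    obtain ⟨π, -, i, hi, -⟩ := exists_fits_of_hIndex (Finset.mem_filter.1 h.choose_spec).2.2
      (j := n + 2) (by omega) le_rfl
    omega
  have hfactor : ∀ i : Fin (n + 1), insertFactor q u t s i.castSucc 0 +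
      insertFactor q u t s i.castSucc 1 =
      (if (i : ℕ) + 1 = 1 then u else 1) *
        (q ^ (n + 2 - ((i : ℕ) + 1)) + q ^ (n + 2 + ((i : ℕ) + 1) - 2)) := by
    intro i
    have h0 : (i.castSucc = 0) ↔ (i : ℕ) + 1 = 1 := by
      rw [Fin.ext_iff, Fin.val_castSucc, Fin.val_zero]
      omega
    have e1 : n + 1 - (i : ℕ) = n + 2 - ((i : ℕ) + 1) := by omega
    have e2 : n + 1 + (i : ℕ) = n + 2 + ((i : ℕ) + 1) - 2 := by omega
    simp only [insertFactor, insertWeight, if_true, one_ne_zero, if_false, Fin.val_castSucc,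
      (Fin.castSucc_lt_last i).ne, mul_one, h0, e1, e2]
    ring
  have hfactor_last : insertFactor q u t s (Fin.last (n + 1)) 0 +
      insertFactor q u t s (Fin.last (n + 1)) 1 =
      t (n + 2) + s (n + 2) * q ^ (2 * (n + 2) - 2) := by
    have e : n + 1 + (n + 1) = 2 * (n + 2) - 2 := by omega
    simp only [insertFactor, insertWeight, if_true, one_ne_zero, if_false, Fin.val_last,
      Nat.sub_self, pow_zero, e, Fin.last_eq_zero_iff]
    simp [mul_comm]
  rw [Finset.sum_filter, Fin.sum_univ_castSucc, if_pos hlast, hfactor_last]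
  simp only [hfactor, ← hIndex_le_iff_of_last hf h, Fin.val_castSucc]
  rw [Fin.sum_univ_eq_sum_range (fun i => if hIndex f (n + 2) ≤ i + 1 then
    (if i + 1 = 1 then u else 1) * (q ^ (n + 2 - (i + 1)) + q ^ (n + 2 + (i + 1) - 2)) else 0),
    ← Finset.sum_filter]
  have : ∑ i ∈ Finset.Ico (hIndex f (n + 2)) (n + 2),
        (if i = 1 then u else 1) * (q ^ (n + 2 - i) + q ^ (n + 2 + i - 2)) =
      ∑ i ∈ (Finset.range (n + 1)).filter (fun i => hIndex f (n + 2) ≤ i + 1),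
        (if i + 1 = 1 then u else 1) * (q ^ (n + 2 - (i + 1)) + q ^ (n + 2 + (i + 1) - 2)) := by
    symm
    refine Finset.sum_bij (fun i _ => i + 1) ?_ ?_ ?_ ?_
    · intro i hi
      simp only [Finset.mem_filter, Finset.mem_range, Finset.mem_Ico] at *
      omega
    · intro i _ j _ hij
      omega
    · intro i hi
      simp only [Finset.mem_filter, Finset.mem_range, Finset.mem_Ico] at *
      exact ⟨i - 1, by omega, by omega⟩
    · intros
      rfl
  rw [this]
  ring

/-- The weight `F` and the family `κ` are left abstract, so that one induction serves both
statistics; in rank one evenness leaves only the identity. -/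
theorem sum_restrictedD_eq_prod
    (F : ∀ m : ℕ, SignedPerm (m + 1) → R)
    (κ : ∀ m : ℕ, Fin (m + 2) → ZMod 2 → SignedPerm (m + 2))
    (hκ : ∀ m, IsInserting (κ m))
    (hF_one : F 0 1 = t 1 * u)
    (hF : ∀ m (π : SignedPerm (m + 1)), π.IsEven → ∀ i c,
      F (m + 1) (π.embed * κ m i c) = F m π * insertFactor q u t s i c)
    (m : ℕ) (f : Fin (m + 1) → ℕ) (hf : Monotone f) (hne : (restrictedD f).Nonempty) :
    ∑ π ∈ restrictedD f, F m π = t 1 * u * ∏ j ∈ Finset.Icc 2 (m + 1),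
      (t j + (∑ i ∈ Finset.Ico (hIndex f j) j,
        (if i = 1 then u else 1) * (q ^ (j - i) + q ^ (j + i - 2))) +
        s j * q ^ (2 * j - 2)) := by
  induction m with
  | zero =>
    obtain ⟨π, hπ⟩ := hne
    have : restrictedD f = {1} := by
      refine Finset.eq_singleton_iff_unique_mem.2 ⟨?_, fun τ hτ =>
        eq_one_of_isEven (Finset.mem_filter.1 hτ).2.1⟩
      rwa [← eq_one_of_isEven (Finset.mem_filter.1 hπ).2.1]
    simp [this, hF_one]
  | succ m ih =>
    have hmono : Monotone (truncShape f) := fun i j hij =>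
      min_le_min_right _ (hf (by simpa using hij))
    rw [(hκ m).sum_restrictedD hf (F (m + 1)) (F m) _ (hF m),
      ih _ hmono (fits_of_truncShape_nonempty hf hne).1, sum_insertFactor q u t s hf hne,
      Finset.prod_Icc_succ_top (by omega : 2 ≤ m + 1 + 1), ← mul_assoc]
    congr 2
    refine Finset.prod_congr rfl fun j hj => ?_
    rw [Finset.mem_Icc] at hj
    rw [hIndex_truncShape hf hne (by omega) hj.2]

end GeneratingFunction

end SignedPerm

theorem theorem6p5 (n : ℕ) [NeZero n] (f : Fin n → ℕ)
    (hf_one : ∀ i, 1 ≤ f i) (hf_mono : Monotone f) (hf_le : ∀ i, f i ≤ n)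
    (hf_nonempty : (SignedPerm.restrictedD f).Nonempty)
    {R : Type*} [CommSemiring R] (q u : R) (t s : ℕ → R) :
    (∑ π ∈ SignedPerm.restrictedD f,
        q ^ π.lengthD * u ^ π.lmin * (∏ i ∈ π.RmilPlus, t i) * (∏ i ∈ π.RmilMinus, s i)
      = ∑ π ∈ SignedPerm.restrictedD f,
          q ^ π.sorD * u ^ π.lmic * (∏ i ∈ π.CycPlus, t i) * (∏ i ∈ π.CycMinus, s i)) ∧
    (∑ π ∈ SignedPerm.restrictedD f,
        q ^ π.sorD * u ^ π.lmic * (∏ i ∈ π.CycPlus, t i) * (∏ i ∈ π.CycMinus, s i)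
      = t 1 * u * ∏ j ∈ Finset.Icc 2 n,
          (t j
            + (∑ i ∈ Finset.Ico (SignedPerm.hIndex f j) j,
                (if i = 1 then u else 1) * (q ^ (j - i) + q ^ (j + i - 2)))
            + s j * q ^ (2 * j - 2))) := by
  obtain ⟨m, rfl⟩ := Nat.exists_eq_succ_of_ne_zero (NeZero.ne n)
  have h1 := SignedPerm.sum_restrictedD_eq_prod q u t s
    (fun _ => SignedPerm.lengthTerm q u t s) (fun _ => SignedPerm.insertion)
    (fun _ => SignedPerm.isInserting_insertion) (SignedPerm.lengthTerm_one q u t s)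
    (fun _ => SignedPerm.lengthTerm_mul_insertion q u t s) m f hf_mono hf_nonempty
  have h2 := SignedPerm.sum_restrictedD_eq_prod q u t s
    (fun _ => SignedPerm.sortTerm q u t s) (fun _ => SignedPerm.sorter)
    (fun _ => SignedPerm.isInserting_sorter) (SignedPerm.sortTerm_one q u t s)
    (fun _ => SignedPerm.sortTerm_mul_sorter q u t s) m f hf_mono hf_nonempty
  exact ⟨h1.trans h2.symm, h2⟩
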